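/- Let $m\ge 0$ and $[m]=\{1,\dots,m\}$. A *polymatroid* $P$ on a finite set $E$ is a function $\mathrm{rk}_P\colon 2^{E}\to\mathbb Z_{\ge 0}$ that is submodular ($\mathrm{rk}_P(I\cap J)+\mathrm{rk}_P(I\cup J)\le \mathrm{rk}_P(I)+\mathrm{rk}_P(J)$), monotone, and satisfies $\mathrm{rk}_P(\emptyset)=0$; its rank is $r=\mathrm{rk}_P(E)$. Its independence polytope and base polytope are $$I(P)=\Big\{x\in\mathbb R_{\ge 0}^{E}:\sum_{i\in I}x_i\le \mathrm{rk}_P(I)\ \text{for all } I\subseteq E\Big\},\qquad B(P)=\Big\{x\in I(P):\sum_{i\in E}x_i=r\Big\}.$$ For a polymatroid $P$ of rank $r$ on $[m]$ and $\mathbf b\in\mathbb Z_{\ge 0}^m$ with $|\mathbf b|=\sum_i b_i$, define integers $c_{\mathbf b}$ recursively: $c_{\mathbf b}=0$ if $\mathbf b\notin I(P)$; $c_{\mathbf b}=1$ if $\mathbf b\in I(P)$ and $|\mathbf b|=r$ (that is, $\mathbf b\in B(P)$); and $$c_{\mathbf b}=1-\sum_{\mathbf b'>\mathbf b}c_{\mathbf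 b'}\qquad\text{if } \mathbf b\in I(P)\text{ and }|\mathbf b|<r,$$ where $\mathbf b'>\mathbf b$ means $\mathbf b'\ne\mathbf b$ and $b'_i\ge b_i$ for all $i$. Put $$g_P(t_0,t_1,\dots,t_m)=\sum_{\mathbf k\in I(P)\cap\mathbb Z^m}c_{\mathbf k}\,(-t_0)^{r-|\mathbf k|}\,t_1^{k_1}\cdots t_m^{k_m}.$$ A homogeneous polynomial $f$ of degree $d$ with nonnegative real coefficients in a finite set of variables is *Lorentzian* if the set of exponent vectors of its nonzero terms equals the set of lattice points of $B(Q)$ for some polymatroid $Q$ on the set of variables, and every $(d-2)$-th partial derivative of $f$ is a quadratic form with at most one positive eigenvalue (no condition if $d<2$). A polynomial $f=\sum_{\mathbf k}a_{\mathbf k}\mathbf t^{\mathbf k}$ is *denormalized Lorentzian* if its normalization $N(f)=\sum_{\mathbf k}a_{\mathbf k}\mathbf t^{\mathbf k}/\mathbf k!$ is Lorentzian, where $\mathbf k!=\prod_i k_i!$. **Corollary.** Let $P$ be a polymatroid of rank $r$ on $[m]$ such that $\mathrm{rk}_P(\{i\})=r$ for some $i\in[m]$. Then $g_P$ is a denormalized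 Lorentzian polynomial, homogeneous of degree $r$. In particular, the set of exponent vectors of the nonzero terms of $g_P$ is the set of lattice points of the base polytope of a polymatroid on $\{0,1,\dots,m\}$. -/

import Mathlib

open MvPolynomial

/-- A polymatroid on a finite set `E`, given by its rank function. (Every such function has the
cage `i ↦ rk {i}`, so no cage is part of the data.) -/
structure Polymatroid (E : Type*) [Fintype E] [DecidableEq E] where
  /-- the rank function -/
  rk : Finset E → ℕ
  submodular : ∀ I J : Finset E, rk (I ∩ J) + rk (I ∪ J) ≤ rk I + rk J
  monotone : ∀ I J : Finset E, I ⊆ J → rk I ≤ rk J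
  normalized : rk ∅ = 0

namespace Polymatroid

variable {E : Type*} [Fintype E] [DecidableEq E]

/-- The rank `rk(E)` of a polymatroid. -/
def rank (P : Polymatroid E) : ℕ := P.rk Finset.univ

/-- The base polytope `B(P)`. -/
def basePolytope (P : Polymatroid E) : Set (E → ℝ) :=
  {x | (∀ i, 0 ≤ x i) ∧ ∑ i, x i = (P.rank : ℝ) ∧ ∀ I : Finset E, ∑ i ∈ I, x i ≤ (P.rk I : ℝ)}

/-- The independence polytope `I(P)`. -/
def independencePolytope (P : Polymatroid E) : Set (E → ℝ) :=
  {x | (∀ i, 0 ≤ x i) ∧ ∀ I : Finset E, ∑ i ∈ I, x i ≤ (P.rk I : ℝ)}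

/-- The smallest cage of `P`. -/
def cage (P : Polymatroid E) : E → ℕ := fun i => P.rk {i}

open Classical in
/-- The lattice points of the independence polytope. All of them lie in the box given by the cage,
so they form a finite set; see `mem_independentPoints`. -/
noncomputable def independentPoints (P : Polymatroid E) : Finset (E → ℕ) :=
  (Finset.Iic P.cage).filter (fun b => (fun i => (b i : ℝ)) ∈ P.independencePolytope)

theorem mem_independentPoints (P : Polymatroid E) (b : E → ℕ) :
    b ∈ P.independentPoints ↔ (fun i => (b i : ℝ)) ∈ P.independencePolytope := by
  classical
  unfold independentPoints
  rw [Finset.mem_filter, Finset.mem_Iic]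
  refine ⟨fun h => h.2, fun h => ⟨fun i => ?_, h⟩⟩
  have h1 := h.2 {i}
  rw [Finset.sum_singleton] at h1
  exact_mod_cast h1

open Classical in
/-- The recursively defined coefficients `c_b`, for `b` a vector of nonnegative integers:
* `c_b = 0` unless `b` is a lattice point of the independence polytope `I(P)`;
* if `b` is a lattice point of `I(P)` with `|b| = r`, i.e. of the base polytope, then `c_b = 1`;
* if `b` is a lattice point of `I(P)` with `|b| < r`, then `c_b = 1 - ∑_{b' > b} c_{b'}`.

The sum is over the `b' > b` in the box given by the cage, outside of which all `c_{b'}` vanish. -/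
noncomputable def knutsonCoeff (P : Polymatroid E) (b : E → ℕ) : ℤ :=
  if P.rank < ∑ i, b i then 0
  else if ∑ i, b i = P.rank then
    if (fun i => (b i : ℝ)) ∈ P.basePolytope then 1 else 0
  else if (fun i => (b i : ℝ)) ∈ P.independencePolytope then
    1 - ∑ b' ∈ (Finset.Ioc b P.cage).attach, knutsonCoeff P b'.1
  else 0
termination_by P.rank - ∑ i, b i
decreasing_by
  have hlt : b < b'.1 := (Finset.mem_Ioc.1 b'.2).1
  obtain ⟨hle, j, hj⟩ := Pi.lt_def.1 hlt
  have hs : ∑ i, b i < ∑ i, b'.1 i :=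
    Finset.sum_lt_sum (fun i _ => hle i) ⟨j, Finset.mem_univ j, hj⟩
  omega

/-- The polynomial `g_P(t_0, t_1, …, t_m) = ∑_{k ∈ I(P) ∩ ℤ^m} c_k (-t_0)^{r - |k|} t^k` of a
polymatroid on `[m]`. The variable `t_0` is `X 0`, and the variable attached to the element `i` of
the ground set is `X i.succ`. -/
noncomputable def gPoly {m : ℕ} (P : Polymatroid (Fin m)) : MvPolynomial (Fin (m + 1)) ℝ :=
  ∑ k ∈ P.independentPoints,
    C (P.knutsonCoeff k : ℝ) * (-X 0) ^ (P.rank - ∑ i, k i) * ∏ i, X i.succ ^ k i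

end Polymatroid

namespace MvPolynomial

variable {σ : Type*}

/-- The set `s` of exponent vectors is the set of lattice points of the base polytope of some
polymatroid on the set of variables. -/
def IsBasePolytopeLattice [Fintype σ] [DecidableEq σ] (s : Set (σ →₀ ℕ)) : Prop :=
  ∃ Q : Polymatroid σ, s = {k | (fun i => (k i : ℝ)) ∈ Q.basePolytope}

/-- The iterated partial derivative `∂_{i_1} ⋯ ∂_{i_n} f` for a list `[i_1, …, i_n]`. -/
noncomputable def iterPDeriv (l : List σ) (f : MvPolynomial σ ℝ) : MvPolynomial σ ℝ :=
  l.foldr (fun i g => pderiv i g) f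

/-- The Hessian matrix of `q` at the origin. If `q` is a quadratic form, this is twice the symmetric
matrix that represents `q`. -/
noncomputable def hessianMatrix (q : MvPolynomial σ ℝ) : Matrix σ σ ℝ :=
  Matrix.of fun i j => constantCoeff (pderiv i (pderiv j q))

theorem isHermitian_hessianMatrix (q : MvPolynomial σ ℝ) : (hessianMatrix q).IsHermitian := by
  refine Matrix.IsHermitian.ext fun i j => ?_
  have h : pderiv j (pderiv i q) = pderiv i (pderiv j q) := by
    classical
    have h0 : ⁅(pderiv j : Derivation ℝ (MvPolynomial σ ℝ) (MvPolynomial σ ℝ)),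
        (pderiv i : Derivation ℝ (MvPolynomial σ ℝ) (MvPolynomial σ ℝ))⁆ = 0 := by
      refine MvPolynomial.derivation_ext fun k => ?_
      rw [Derivation.commutator_apply, pderiv_X, pderiv_X]
      by_cases hi : i = k <;> by_cases hj : j = k <;>
        simp [hi, hj, Ne.symm]
    have h1 := DFunLike.congr_fun h0 q
    rw [Derivation.commutator_apply] at h1
    exact sub_eq_zero.1 h1
  simp [hessianMatrix, h]

/-- `q`, thought of as a quadratic form, has at most one positive eigenvalue, counted with
multiplicity. -/
def HasAtMostOnePosEigenvalue [Fintype σ] [DecidableEq σ] (q : MvPolynomial σ ℝ) : Prop :=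
  {i | 0 < (isHermitian_hessianMatrix q).eigenvalues i}.ncard ≤ 1

/-- `f` is a Lorentzian polynomial of degree `d`. The last condition is about all `(d - 2)`-th
partial derivatives, and is void if `d < 2`. -/
structure IsLorentzian [Fintype σ] [DecidableEq σ] (d : ℕ) (f : MvPolynomial σ ℝ) : Prop where
  isHomogeneous : f.IsHomogeneous d
  coeff_nonneg : ∀ k, 0 ≤ f.coeff k
  support : IsBasePolytopeLattice {k | 0 < f.coeff k}
  hessian : ∀ l : List σ, l.length + 2 = d → HasAtMostOnePosEigenvalue (iterPDeriv l f)

/-- The normalization `N(f)`: each term `c_k t^k` is replaced by `c_k t^k / k!`. -/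
noncomputable def normalization [Fintype σ] (f : MvPolynomial σ ℝ) : MvPolynomial σ ℝ :=
  ∑ k ∈ f.support, monomial k (f.coeff k / (∏ i, (k i).factorial : ℕ))

/-- `f` is denormalized Lorentzian of degree `d`. -/
def IsDenormalizedLorentzian [Fintype σ] [DecidableEq σ] (d : ℕ) (f : MvPolynomial σ ℝ) : Prop :=
  IsLorentzian d (normalization f)

end MvPolynomial

/-! The recursion makes `c` the Möbius inverse of the constant 1 on the lattice points of `I(P)`. If
`{i}` has full rank and `F = [m] \ {i}`, this inverse is explicit (`knutsonCoeff_eq`): `(-1)^(r-|b|)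
c_b` is the number of `S ⊆ F` with `b + 1_S` a base. Indeed, when the signed counts are summed over
all `b' ≥ b` and grouped by the base `a = b' + 1_S`, each `a` receives an alternating sum over the
subsets of `{j ∈ F : b_j < a_j}`. Only the base that agrees with `b` off `i` survives. The signs
cancel against `-t_0`, so the coefficient of `t_0^p t^b` in `g_P` is the count `extensionCount`.

Support: the exponents with nonzero count are the bases of the polymatroid `extension`, by a min-max
argument (`mem_bases_extension_iff`).

Signature: the pairs `(b, c)` with `c ≤ 1_F` and `b + c` a base form an M-convex set
(`isMConvex_splitSet`). The Hessians of its generating polynomial `∑ t^α / α!` satisfy a reverse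
Cauchy-Schwarz inequality (`hyperbolic_coeffHessian_indicator`), and this passes to nonnegative
directional derivatives (`hyperbolic_coeffHessian_iterate`), by a spectral argument on matrices
(`Matrix.hyperbolic_of_trilinear`). Setting every variable of the second group equal to `t_0` gives
the counts of `g_P` with an extra factor `p!`. After `t_0` is rescaled by `1/(p+1)`, removing these
factors only lowers the `(0,0)` entry of each Hessian, which creates no positive eigenvalue. -/

open scoped Matrix

/-! ### Reverse Cauchy-Schwarz inequalities for nonnegative matrices. -/

namespace Matrix

variable {ι : Type*} [Fintype ι]

/-- The reverse Cauchy-Schwarz inequality for the bilinear form of `A`, for vectors in the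
nonnegative orthant. -/
def Hyperbolic (A : Matrix ι ι ℝ) : Prop :=
  ∀ u x : ι → ℝ, (∀ i, 0 ≤ u i) →
    (x ⬝ᵥ A *ᵥ x) * (u ⬝ᵥ A *ᵥ u) ≤ (x ⬝ᵥ A *ᵥ u) ^ 2

theorem IsSymm.dotProduct_mulVec_comm {A : Matrix ι ι ℝ} (hA : A.IsSymm) (x y : ι → ℝ) :
    x ⬝ᵥ A *ᵥ y = y ⬝ᵥ A *ᵥ x := by
  rw [dotProduct_mulVec, ← mulVec_transpose, hA.eq, dotProduct_comm]

theorem dotProduct_mulVec_nonneg {A : Matrix ι ι ℝ} (hA : ∀ i j, 0 ≤ A i j) {u v : ι → ℝ}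
    (hu : ∀ i, 0 ≤ u i) (hv : ∀ i, 0 ≤ v i) : 0 ≤ u ⬝ᵥ A *ᵥ v :=
  Finset.sum_nonneg fun i _ => mul_nonneg (hu i) <|
    Finset.sum_nonneg fun j _ => mul_nonneg (hA i j) (hv j)

/-- If the form of `A` is nonpositive on the orthogonal complement of a positive vector, then it
satisfies the reverse Cauchy-Schwarz inequality. -/
theorem hyperbolic_of_nonpos_of_orthogonal {A : Matrix ι ι ℝ} (hA : A.IsSymm)
    (h0 : ∀ i j, 0 ≤ A i j) {v : ι → ℝ}
    (h : ∀ x, x ⬝ᵥ A *ᵥ v = 0 → x ⬝ᵥ A *ᵥ x ≤ 0) : Hyperbolic A := by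
  intro u x hu
  have hb : 0 ≤ u ⬝ᵥ A *ᵥ u := dotProduct_mulVec_nonneg h0 hu hu
  by_contra! hc
  set a := x ⬝ᵥ A *ᵥ x
  set b := u ⬝ᵥ A *ᵥ u
  set c := x ⬝ᵥ A *ᵥ u with hcdef
  set s := u ⬝ᵥ A *ᵥ v with hs
  set t := x ⬝ᵥ A *ᵥ v with ht
  have ha : 0 < a := by
    by_contra! ha
    nlinarith [sq_nonneg c]
  have hcu : u ⬝ᵥ A *ᵥ x = c := hA.dotProduct_mulVec_comm u x
  -- The combination of `x` and `u` that is `A`-orthogonal to `v`. Multiplied by `a > 0`, its form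
  -- becomes a square plus `t² (ab - c²)`, which forces `t = 0`.
  have hz := h (s • x - t • u) (by
    rw [sub_dotProduct, smul_dotProduct, smul_dotProduct, ← hs, ← ht]
    simp only [smul_eq_mul]; ring)
  have hexp : (s • x - t • u) ⬝ᵥ A *ᵥ (s • x - t • u) = s ^ 2 * a - 2 * s * t * c + t ^ 2 * b := by
    simp only [mulVec_sub, mulVec_smul, sub_dotProduct, dotProduct_sub, smul_dotProduct,
      dotProduct_smul, smul_eq_mul, hcu]
    ring
  rw [hexp] at hz
  have h1 : (s * a - t * c) ^ 2 + t ^ 2 * (a * b - c ^ 2) ≤ 0 := by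
    have : (s * a - t * c) ^ 2 + t ^ 2 * (a * b - c ^ 2)
      = a * (s ^ 2 * a - 2 * s * t * c + t ^ 2 * b) := by ring
    rw [this]
    exact mul_nonpos_of_nonneg_of_nonpos ha.le hz
  have h2 : t = 0 := by
    by_contra h3
    have : 0 < t ^ 2 := by positivity
    nlinarith [sq_nonneg (s * a - t * c), mul_pos this (sub_pos.2 hc)]
  exact absurd (h x h2) (not_le.2 ha)

/-- A form of signature `(1, *)` on the span of the linear forms involved is hyperbolic. -/
theorem hyperbolic_of_eq_sq_sub {κ : Type*} [Fintype κ] {A : Matrix ι ι ℝ}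
    (h0 : ∀ i j, 0 ≤ A i j) (f : (ι → ℝ) → ℝ) (g : κ → (ι → ℝ) → ℝ)
    (h : ∀ x y, x ⬝ᵥ A *ᵥ y = f x * f y - ∑ l, g l x * g l y) : Hyperbolic A := by
  intro u x hu
  have hb : 0 ≤ u ⬝ᵥ A *ᵥ u := dotProduct_mulVec_nonneg h0 hu hu
  rw [h, h, h] at *
  have hcs := Finset.sum_mul_sq_le_sq_mul_sq Finset.univ (fun l => g l x) (fun l => g l u)
  simp only [← sq] at *
  set a := ∑ l, g l x ^ 2 with ha
  set b := ∑ l, g l u ^ 2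
  set c := ∑ l, g l x * g l u
  have ha0 : 0 ≤ a := Finset.sum_nonneg fun l _ => sq_nonneg _
  have hb0 : 0 ≤ b := Finset.sum_nonneg fun l _ => sq_nonneg _
  generalize f x = s at *
  generalize f u = t at *
  rcases le_or_gt (s ^ 2) a with hs | hs
  · exact (mul_nonpos_of_nonpos_of_nonneg (by linarith) hb).trans (sq_nonneg _)
  -- Cauchy-Schwarz `c² ≤ ab` combined with AM-GM.
  · have h1 : (2 * (s * t * c)) ^ 2 ≤ (s ^ 2 * b + t ^ 2 * a) ^ 2 := by
      have : s ^ 2 * t ^ 2 * c ^ 2 ≤ s ^ 2 * t ^ 2 * (a * b) := by gcongr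
      nlinarith [sq_nonneg (s ^ 2 * b - t ^ 2 * a)]
    have h2 := abs_le_of_sq_le_sq h1 (by positivity)
    have h3 : s ^ 2 * ((s * t - c) ^ 2 - (s ^ 2 - a) * (t ^ 2 - b)) =
        ((s ^ 2 - a) * t - s * (s * t - c)) ^ 2
          + (s ^ 2 - a) * (s ^ 2 * b + t ^ 2 * a - 2 * (s * t * c)) := by ring
    have h4 : 0 ≤ s ^ 2 * ((s * t - c) ^ 2 - (s ^ 2 - a) * (t ^ 2 - b)) := by
      rw [h3]
      exact add_nonneg (sq_nonneg _) (mul_nonneg (sub_nonneg.2 hs.le)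
        (sub_nonneg.2 ((le_abs_self _).trans h2)))
    exact sub_nonneg.1 (nonneg_of_mul_nonneg_right h4 (ha0.trans_lt hs))

end Matrix

/-! ### The spectral local-to-global principle. -/

namespace Matrix

variable {ι : Type*} [Fintype ι]

/-- Perron-Frobenius type estimate: a symmetric nonnegative matrix `A` is dominated by the diagonal
matrix with entries `(A v)_j / v_j`, with an explicit formula for the difference. -/
theorem sum_mul_sq_sub_eq {A : Matrix ι ι ℝ} (hA : A.IsSymm) {v : ι → ℝ} (hv : ∀ i, 0 < v i)
    (z : ι → ℝ) :
    ∑ j, ∑ k, A j k * v j * v k * (z j / v j - z k / v k) ^ 2 =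
      2 * ∑ j, (A *ᵥ v) j / v j * z j ^ 2 - 2 * (z ⬝ᵥ A *ᵥ z) := by
  have h1 : ∀ j k, A j k * v j * v k * (z j / v j - z k / v k) ^ 2 =
      A j k * v k / v j * z j ^ 2 + A j k * v j / v k * z k ^ 2 - 2 * (z j * (A j k * z k)) := by
    intro j k
    have := (hv j).ne'
    have := (hv k).ne'
    field_simp
    ring
  have h2 : ∑ j, ∑ k, A j k * v k / v j * z j ^ 2 = ∑ j, (A *ᵥ v) j / v j * z j ^ 2 := by
    simp only [mulVec, dotProduct, Finset.sum_div, Finset.sum_mul]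
  have h3 : ∑ j, ∑ k, A j k * v j / v k * z k ^ 2 = ∑ j, (A *ᵥ v) j / v j * z j ^ 2 := by
    rw [← h2, Finset.sum_comm]
    refine Finset.sum_congr rfl fun j _ => Finset.sum_congr rfl fun k _ => ?_
    rw [hA.apply j k]
  simp only [h1, Finset.sum_add_distrib, Finset.sum_sub_distrib, h2, h3]
  have h4 : ∑ j, ∑ k, 2 * (z j * (A j k * z k)) = 2 * (z ⬝ᵥ A *ᵥ z) := by
    simp only [dotProduct, mulVec, Finset.mul_sum]
  rw [h4]
  ring

theorem sum_dotProduct_eigenvectorBasis [DecidableEq ι] {M : Matrix ι ι ℝ} (hM : M.IsHermitian)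
    (x : ι → ℝ) :
    x ⬝ᵥ M *ᵥ x = ∑ i, hM.eigenvalues i * (x ⬝ᵥ ⇑(hM.eigenvectorBasis i)) ^ 2 := by
  have h := hM.eigenvectorBasis.sum_inner_mul_inner (WithLp.toLp 2 x) (WithLp.toLp 2 (M *ᵥ x))
  have hs : M.IsSymm := IsSymm.ext fun i j => by simpa using hM.apply i j
  simp only [EuclideanSpace.inner_eq_star_dotProduct, star_trivial] at h
  rw [dotProduct_comm, ← h]
  refine Finset.sum_congr rfl fun i _ => ?_
  rw [dotProduct_comm (M *ᵥ x), hs.dotProduct_mulVec_comm, hM.mulVec_eigenvectorBasis,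
    dotProduct_smul, dotProduct_comm x]
  simp only [smul_eq_mul]
  ring

/-- The local-to-global principle for the reverse Cauchy-Schwarz inequality. -/
theorem hyperbolic_of_trilinear {T : ι → Matrix ι ι ℝ} {v : ι → ℝ} (hv : ∀ i, 0 < v i)
    (h0 : ∀ i j k, 0 ≤ T i j k) (h12 : ∀ i j k, T i j k = T j i k)
    (h23 : ∀ i j k, T i j k = T i k j) (hT : ∀ i, Hyperbolic (T i)) {A : Matrix ι ι ℝ}
    (hA : ∀ j k, A j k = ∑ i, v i * T i j k)
    (hconn : ∀ j k, (∃ l, 0 < A j l) → (∃ l, 0 < A k l) →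
      Relation.ReflTransGen (fun a b => 0 < A a b) j k) : Hyperbolic A := by
  classical
  have hA0 : ∀ j k, 0 ≤ A j k := fun j k => by
    rw [hA]; exact Finset.sum_nonneg fun i _ => mul_nonneg (hv i).le (h0 _ _ _)
  have hAs : A.IsSymm := IsSymm.ext fun j k => by
    simp only [hA]; exact Finset.sum_congr rfl fun i _ => by rw [h23]
  set w := A *ᵥ v with hw
  have hw0 : ∀ k, 0 ≤ w k := fun k =>
    Finset.sum_nonneg fun j _ => mul_nonneg (hA0 _ _) (hv j).le
  have hwz : ∀ k, w k = 0 → ∀ j, A k j = 0 := fun k hk j => by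
    have := (Finset.sum_eq_zero_iff_of_nonneg
      (fun j _ => mul_nonneg (hA0 k j) (hv j).le)).1 hk j (Finset.mem_univ j)
    exact (mul_eq_zero.1 this).resolve_right (hv j).ne'
  have hwp : ∀ k, w k ≠ 0 → ∃ l, 0 < A k l := fun k hk => by
    by_contra! h
    apply hk
    exact Finset.sum_eq_zero fun j _ => mul_eq_zero_of_left (le_antisymm (h j) (hA0 k j)) _
  have hTA : ∀ k x, (A *ᵥ x) k = x ⬝ᵥ T k *ᵥ v := fun k x => by
    simp only [mulVec, dotProduct, hA, Finset.sum_mul, Finset.mul_sum]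
    refine Finset.sum_congr rfl fun j _ => Finset.sum_congr rfl fun i _ => ?_
    rw [h12 i k j, h23 k i j]; ring
  have hTz : ∀ k, w k = 0 → T k = 0 := fun k hk => by
    ext a b
    have h1 := hwz k hk b
    rw [hA, Finset.sum_eq_zero_iff_of_nonneg
      (fun i _ => mul_nonneg (hv i).le (h0 _ _ _))] at h1
    have := (mul_eq_zero.1 (h1 a (Finset.mem_univ a))).resolve_left (hv a).ne'
    rw [h12] at this
    simpa using this
  -- Hyperbolicity of each `T k` tested against `v`, using `v·T_k v = w k` and `x·T_k v = (A x) k`,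
  -- then averaged with weights `v k`.
  have key : ∀ x, x ⬝ᵥ A *ᵥ x ≤ ∑ k, v k * ((A *ᵥ x) k ^ 2 / w k) := fun x => by
    have h1 : x ⬝ᵥ A *ᵥ x = ∑ k, v k * (x ⬝ᵥ T k *ᵥ x) := by
      simp only [dotProduct, mulVec, hA, Finset.sum_mul, Finset.mul_sum]
      rw [Finset.sum_comm]
      conv_lhs => enter [2, a]; rw [Finset.sum_comm]
      rw [Finset.sum_comm]
      refine Finset.sum_congr rfl fun i _ => ?_
      rw [Finset.sum_comm]
      refine Finset.sum_congr rfl fun a _ => Finset.sum_congr rfl fun b _ => ?_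
      ring
    rw [h1]
    refine Finset.sum_le_sum fun k _ => mul_le_mul_of_nonneg_left ?_ (hv k).le
    rcases eq_or_ne (w k) 0 with hk | hk
    · simp [hTz k hk, hk]
    · rw [le_div_iff₀ (lt_of_le_of_ne (hw0 k) hk.symm), hTA]
      have := hT k v x fun i => (hv i).le
      rwa [← hTA k v, ← hw] at this
  -- Conjugation by `d` turns `key` into a bound on eigenvalues of `M`. Where `w k = 0`, both `d k`
  -- and `e k` are 0; this is harmless because row and column `k` of `A` vanish.
  set d : ι → ℝ := fun k => √(v k / w k) with hd
  set e : ι → ℝ := fun k => √(w k / v k) with he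
  have hd2 : ∀ k, d k ^ 2 = v k / w k := fun k =>
    Real.sq_sqrt (div_nonneg (hv k).le (hw0 k))
  have hde : ∀ k, w k ≠ 0 → d k * e k = 1 := fun k hk => by
    have := (hv k).ne'
    rw [hd, he, ← Real.sqrt_mul (div_nonneg (hv k).le (hw0 k))]
    rw [show v k / w k * (w k / v k) = 1 by field_simp, Real.sqrt_one]
  have hAde : ∀ j k, A j k * (d k * e k) = A j k := fun j k => by
    rcases eq_or_ne (w k) 0 with hk | hk
    · rw [← hAs.apply, hwz k hk, zero_mul]
    · rw [hde k hk, mul_one]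
  set M : Matrix ι ι ℝ := Matrix.of fun j k => d j * A j k * d k with hMdef
  have hM : M.IsHermitian := by
    ext j k
    simp only [hMdef, conjTranspose_apply, of_apply, star_trivial]
    rw [← hAs.apply]; ring
  have hMv : ∀ y k, (M *ᵥ y) k = d k * (A *ᵥ fun j => d j * y j) k := fun y k => by
    simp only [hMdef, mulVec, dotProduct, of_apply, Finset.mul_sum]
    exact Finset.sum_congr rfl fun j _ => by ring
  have hMq : ∀ x y, x ⬝ᵥ M *ᵥ y = (fun j => d j * x j) ⬝ᵥ A *ᵥ (fun j => d j * y j) :=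
    fun x y => by
      simp only [dotProduct, hMv]
      exact Finset.sum_congr rfl fun j _ => by ring
  refine hyperbolic_of_nonpos_of_orthogonal hAs hA0 (v := v) fun x hx => ?_
  have hAex : ∀ y : ι → ℝ, (A *ᵥ fun j => d j * (e j * y j)) = A *ᵥ y := fun y => by
    funext k
    simp only [mulVec, dotProduct]
    refine Finset.sum_congr rfl fun j _ => ?_
    rw [← mul_assoc (d j), ← mul_assoc, hAde]
  have hxM : x ⬝ᵥ A *ᵥ x = (fun j => e j * x j) ⬝ᵥ M *ᵥ fun j => e j * x j := by
    rw [hMq, hAex, hAs.dotProduct_mulVec_comm (fun j => d j * (e j * x j)) x, hAex]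
  rw [hxM, sum_dotProduct_eigenvectorBasis hM]
  refine Finset.sum_nonpos fun i _ => ?_
  set y : ι → ℝ := ⇑(hM.eigenvectorBasis i) with hy
  set μ := hM.eigenvalues i with hμ
  have hMy : M *ᵥ y = μ • y := hM.mulVec_eigenvectorBasis i
  have hyy : y ⬝ᵥ y = 1 := by
    have h1 := hM.eigenvectorBasis.orthonormal.1 i
    have h2 : (inner ℝ (hM.eigenvectorBasis i) (hM.eigenvectorBasis i) : ℝ) = 1 := by
      rw [real_inner_self_eq_norm_sq, h1, one_pow]
    rwa [EuclideanSpace.inner_eq_star_dotProduct, star_trivial] at h2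
  rcases le_or_gt μ 0 with hneg | hpos
  · exact mul_nonpos_of_nonpos_of_nonneg hneg (sq_nonneg _)
  set z : ι → ℝ := fun j => d j * y j with hz
  have hzAz : z ⬝ᵥ A *ᵥ z = μ := by
    rw [← hMq, hMy, dotProduct_smul, hyy, smul_eq_mul, mul_one]
  have hdAz : ∀ k, d k * (A *ᵥ z) k = μ * y k := fun k => by
    rw [← hMv, hMy, Pi.smul_apply, smul_eq_mul]
  -- For `z = d y` the inequality `key` reads `μ ≤ μ²`, so a positive eigenvalue is at least 1.
  have h1le : 1 ≤ μ := by
    have h1 := key z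
    have h2 : ∑ k, v k * ((A *ᵥ z) k ^ 2 / w k) = μ ^ 2 := by
      calc _ = ∑ k, (d k * (A *ᵥ z) k) ^ 2 := Finset.sum_congr rfl fun k _ => by
              rw [mul_pow, hd2]; ring
        _ = μ ^ 2 * (y ⬝ᵥ y) := by
              simp only [hdAz, dotProduct, Finset.mul_sum]
              exact Finset.sum_congr rfl fun k _ => by ring
        _ = μ ^ 2 := by rw [hyy, mul_one]
    rw [h2, hzAz] at h1
    nlinarith
  -- The Perron-Frobenius identity gives the opposite bound `μ ≤ 1`. Equality makes `z / v` constant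
  -- along edges of `A`, so by connectivity `z` is proportional to `v` wherever `w` is nonzero.
  have hzero : ∑ j, ∑ k, A j k * v j * v k * (z j / v j - z k / v k) ^ 2 ≤ 0 := by
    rw [sum_mul_sq_sub_eq hAs hv, hzAz]
    have : ∑ j, (A *ᵥ v) j / v j * z j ^ 2 ≤ y ⬝ᵥ y := by
      refine Finset.sum_le_sum fun j _ => ?_
      rw [← hw, hz, mul_pow, hd2, ← mul_assoc]
      rcases eq_or_ne (w j) 0 with hk | hk
      · rw [hk]; simp [mul_self_nonneg]
      · have := (hv j).ne'
        rw [show w j / v j * (v j / w j) = 1 by field_simp]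
        nlinarith
    rw [hyy] at this
    linarith
  have hterm : ∀ j k, 0 ≤ A j k * v j * v k * (z j / v j - z k / v k) ^ 2 := fun j k =>
    mul_nonneg (mul_nonneg (mul_nonneg (hA0 j k) (hv j).le) (hv k).le) (sq_nonneg _)
  have hadj : ∀ j k, 0 < A j k → z j / v j = z k / v k := fun j k hjk => by
    have h1 := (Finset.sum_eq_zero_iff_of_nonneg fun j _ =>
      Finset.sum_nonneg fun k _ => hterm j k).1
      (le_antisymm hzero (Finset.sum_nonneg fun j _ => Finset.sum_nonneg fun k _ => hterm j k))
      j (Finset.mem_univ j)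
    have h2 := (Finset.sum_eq_zero_iff_of_nonneg fun k _ => hterm j k).1 h1 k (Finset.mem_univ k)
    have h3 : 0 < A j k * v j * v k := mul_pos (mul_pos hjk (hv j)) (hv k)
    have h4 := (mul_eq_zero.1 h2).resolve_left h3.ne'
    exact sub_eq_zero.1 (pow_eq_zero_iff two_ne_zero |>.1 h4)
  obtain ⟨c, hc⟩ : ∃ c : ℝ, ∀ k, w k ≠ 0 → z k = c * v k := by
    by_cases hex : ∃ k, w k ≠ 0
    · obtain ⟨k₀, hk₀⟩ := hex
      refine ⟨z k₀ / v k₀, fun k hk => ?_⟩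
      have hp := hconn k₀ k (hwp _ hk₀) (hwp _ hk)
      have : z k₀ / v k₀ = z k / v k := by
        induction hp with
        | refl => rfl
        | tail _ hbc ih =>
          exact (ih (fun h => by simp [hwz _ h] at hbc)).trans (hadj _ _ hbc)
      rw [this, div_mul_cancel₀ _ (hv k).ne']
    · push Not at hex
      exact ⟨0, fun k hk => absurd (hex k) hk⟩
  have hAz : A *ᵥ z = c • w := by
    funext j
    simp only [hw, mulVec, dotProduct, Pi.smul_apply, smul_eq_mul, Finset.mul_sum]
    refine Finset.sum_congr rfl fun k _ => ?_
    rcases eq_or_ne (w k) 0 with hk | hk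
    · rw [← hAs.apply, hwz k hk]; ring
    · rw [hc k hk]; ring
  -- Since `A z = c w = c A v`, any `x` that is `A`-orthogonal to `v` has no component along an
  -- eigenvector with positive eigenvalue.
  have horth : μ * ((fun j => e j * x j) ⬝ᵥ y) = 0 := by
    have h1 : (fun j => e j * x j) ⬝ᵥ M *ᵥ y = μ * ((fun j => e j * x j) ⬝ᵥ y) := by
      rw [hMy, dotProduct_smul, smul_eq_mul]
    rw [← h1, hMq, hAs.dotProduct_mulVec_comm, hAex, hAs.dotProduct_mulVec_comm, ← hz, hAz,
      dotProduct_smul, hw, hx, smul_zero]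
  rw [(mul_eq_zero.1 horth).resolve_left hpos.ne']
  simp

end Matrix

/-! ### Directional derivatives and M-convex supports. -/

section

variable {ι : Type*} [Fintype ι] [DecidableEq ι]

/-- The exchange property that characterizes M-convex sets of lattice points. -/
def IsMConvex (J : Set (ι → ℕ)) : Prop :=
  ∀ α ∈ J, ∀ β ∈ J, ∀ k, α k < β k →
    ∃ l, β l < α l ∧ α + Pi.single k 1 - Pi.single l 1 ∈ J

/-- If `φ` gives the coefficients of a polynomial in the basis `t ^ α / α!`, then `dirDeriv v φ`
gives the coefficients of its derivative in the direction `v`. -/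
def dirDeriv (v : ι → ℝ) (φ : (ι → ℕ) → ℝ) : (ι → ℕ) → ℝ :=
  fun α => ∑ i, v i * φ (α + Pi.single i 1)

/-- The Hessian matrix at the origin of the `κ`-th derivative of the polynomial with coefficients
`φ` in the basis `t ^ α / α!`. -/
def coeffHessian (φ : (ι → ℕ) → ℝ) (κ : ι → ℕ) : Matrix ι ι ℝ :=
  Matrix.of fun j k => φ (κ + Pi.single j 1 + Pi.single k 1)

theorem iterate_dirDeriv_nonneg {v : ι → ℝ} (hv : ∀ i, 0 ≤ v i) {φ : (ι → ℕ) → ℝ}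
    (hφ : ∀ α, 0 ≤ φ α) (n : ℕ) (α : ι → ℕ) : 0 ≤ (dirDeriv v)^[n] φ α := by
  induction n generalizing α with
  | zero => exact hφ α
  | succ n ih =>
    rw [Function.iterate_succ_apply']
    exact Finset.sum_nonneg fun i _ => mul_nonneg (hv i) (ih _)

/-- With positive weights nothing cancels, so positivity depends only on the support of `φ`. -/
theorem iterate_dirDeriv_pos_iff {v : ι → ℝ} (hv : ∀ i, 0 < v i) {φ : (ι → ℕ) → ℝ}
    (hφ : ∀ α, 0 ≤ φ α) (n : ℕ) (α : ι → ℕ) :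
    0 < (dirDeriv v)^[n] φ α ↔ ∃ β, 0 < φ β ∧ α ≤ β ∧ ∑ i, β i = ∑ i, α i + n := by
  induction n generalizing α with
  | zero =>
    refine ⟨fun h => ⟨α, h, le_rfl, rfl⟩, ?_⟩
    rintro ⟨β, h, hle, hs⟩
    have : α = β := by
      funext i
      exact (Finset.sum_eq_sum_iff_of_le fun i _ => hle i).1 (by simpa using hs.symm) i
        (Finset.mem_univ i)
    exact this ▸ h
  | succ n ih =>
    have hsum : ∀ i, ∑ j, (α + Pi.single i 1 : ι → ℕ) j = ∑ j, α j + 1 := fun i => by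
      simp [Finset.sum_add_distrib]
    rw [Function.iterate_succ_apply', dirDeriv, Finset.sum_pos_iff_of_nonneg fun i _ =>
      mul_nonneg (hv i).le (iterate_dirDeriv_nonneg (fun i => (hv i).le) hφ n _)]
    constructor
    · rintro ⟨i, -, hi⟩
      obtain ⟨β, h1, h2, h3⟩ := (ih _).1 ((mul_pos_iff_of_pos_left (hv i)).1 hi)
      exact ⟨β, h1, le_trans le_self_add h2, by rw [h3, hsum]; ring⟩
    · rintro ⟨β, h1, h2, h3⟩
      obtain ⟨i, -, hi⟩ : ∃ i ∈ Finset.univ, α i < β i :=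
        Finset.exists_lt_of_sum_lt (by omega)
      refine ⟨i, Finset.mem_univ i, mul_pos (hv i) ((ih _).2 ⟨β, h1, fun j => ?_, ?_⟩)⟩
      · have := h2 j
        rcases eq_or_ne j i with rfl | hj
        · simpa using hi
        · simpa [hj] using this
      · rw [hsum, h3]; ring

/-- This supplies the connectivity required by `Matrix.hyperbolic_of_trilinear`. If `j` and `k` are
not adjacent, exchanging `k` into the witness `α` of an edge `j – h` must remove `j`, and the result
witnesses `h – k`. Hence the distance is at most 2. -/
theorem coeffHessian_iterate_connected {v : ι → ℝ} (hv : ∀ i, 0 < v i) {φ : (ι → ℕ) → ℝ}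
    (hφ : ∀ α, 0 ≤ φ α) (hM : IsMConvex {α | 0 < φ α}) (n : ℕ) (κ : ι → ℕ) (j k : ι)
    (hj : ∃ l, 0 < coeffHessian ((dirDeriv v)^[n] φ) κ j l)
    (hk : ∃ l, 0 < coeffHessian ((dirDeriv v)^[n] φ) κ k l) :
    Relation.ReflTransGen (fun a b => 0 < coeffHessian ((dirDeriv v)^[n] φ) κ a b) j k := by
  have hsum : ∀ a b, ∑ i, (κ + Pi.single a 1 + Pi.single b 1 : ι → ℕ) i = ∑ i, κ i + 2 := fun a b => by
    simp [Finset.sum_add_distrib]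
  simp only [coeffHessian, Matrix.of_apply, iterate_dirDeriv_pos_iff hv hφ, hsum] at *
  obtain ⟨h, α, hα, hα1, hα2⟩ := hj
  obtain ⟨h', β, hβ, hβ1, hβ2⟩ := hk
  rcases eq_or_ne j k with rfl | hjk
  · exact Relation.ReflTransGen.refl
  by_cases hadj : κ + Pi.single j 1 + Pi.single k 1 ≤ α
  · exact Relation.ReflTransGen.single ⟨α, hα, hadj, hα2⟩
  have hκα : ∀ x, κ x + (if x = j then 1 else 0) + (if x = h then 1 else 0) ≤ α x := fun x => by
    simpa [Pi.single_apply] using hα1 x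
  have hκβ : ∀ x, κ x + (if x = k then 1 else 0) + (if x = h' then 1 else 0) ≤ β x := fun x => by
    simpa [Pi.single_apply] using hβ1 x
  have hαk : α k = κ k := by
    by_contra hne
    refine hadj fun x => ?_
    have h1 := hκα x
    have h2 := hκα k
    simp only [Pi.add_apply, Pi.single_apply]
    grind
  have hlt : α k < β k := by
    have := hκβ k
    rw [if_pos rfl] at this
    omega
  obtain ⟨l, hl, hmem⟩ := hM α hα β hβ k hlt
  set α' := α + Pi.single k 1 - Pi.single l 1 with hα'
  have hα'x : ∀ x, α' x = α x + (if x = k then 1 else 0) - (if x = l then 1 else 0) := fun x => by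
    simp [hα', Pi.single_apply]
  have hsum' : ∑ i, α' i = ∑ i, κ i + 2 + n := by
    have h1 : α' + Pi.single l 1 = α + Pi.single k 1 := by
      rw [hα']
      refine tsub_add_cancel_of_le fun x => ?_
      simp only [Pi.add_apply, Pi.single_apply]
      grind
    have h2 : ∑ i, (α' + Pi.single l 1 : ι → ℕ) i = ∑ i, (α + Pi.single k 1 : ι → ℕ) i := by rw [h1]
    simp only [Pi.add_apply, Finset.sum_add_distrib, Finset.sum_pi_single', Finset.mem_univ,
      if_true] at h2
    omega
  by_cases hadj' : κ + Pi.single j 1 + Pi.single k 1 ≤ α'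
  · exact Relation.ReflTransGen.single ⟨α', hmem, hadj', hsum'⟩
  have hlj : l = j := by
    by_contra hne
    refine hadj' fun x => ?_
    have h1 := hκα x
    have h2 := hα'x x
    have h3 := hκβ l
    simp only [Pi.add_apply, Pi.single_apply]
    grind
  have hαj : α j = κ j + 1 := by
    by_contra hne
    refine hadj' fun x => ?_
    have h1 := hκα x
    have h2 := hα'x x
    have h3 := hκα j
    simp only [Pi.add_apply, Pi.single_apply]
    grind
  have hhj : h ≠ j := by
    rintro rfl
    have := hκα h
    simp at this
    omega
  have hhk : h ≠ k := by
    rintro rfl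
    have := hκα h
    simp at this
    omega
  refine Relation.ReflTransGen.head ⟨α, hα, hα1, hα2⟩
    (Relation.ReflTransGen.single ⟨α', hmem, fun x => ?_, hsum'⟩)
  have h1 := hκα x
  have h2 := hα'x x
  simp only [Pi.add_apply, Pi.single_apply]
  grind

/-- If all quadratic derivatives of a polynomial with M-convex support satisfy the reverse
Cauchy-Schwarz inequality, then so do the quadratic forms obtained by positive directional
derivatives. -/
theorem hyperbolic_coeffHessian_iterate_of_pos {v : ι → ℝ} (hv : ∀ i, 0 < v i)
    {φ : (ι → ℕ) → ℝ} (hφ : ∀ α, 0 ≤ φ α) (hM : IsMConvex {α | 0 < φ α})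
    (hH : ∀ κ, (coeffHessian φ κ).Hyperbolic) (n : ℕ) (κ : ι → ℕ) :
    (coeffHessian ((dirDeriv v)^[n] φ) κ).Hyperbolic := by
  induction n generalizing κ with
  | zero => exact hH κ
  | succ n ih =>
    refine Matrix.hyperbolic_of_trilinear
      (T := fun i => coeffHessian ((dirDeriv v)^[n] φ) (κ + Pi.single i 1)) hv
      (fun i j k => iterate_dirDeriv_nonneg (fun i => (hv i).le) hφ n _) (fun i j k => ?_)
      (fun i j k => ?_) (fun i => ih _) (fun j k => ?_)
      (coeffHessian_iterate_connected hv hφ hM (n + 1) κ)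
    · simp only [coeffHessian, Matrix.of_apply, add_right_comm]
    · simp only [coeffHessian, Matrix.of_apply, add_right_comm]
    · simp only [coeffHessian, Matrix.of_apply, Function.iterate_succ_apply', dirDeriv]
      refine Finset.sum_congr rfl fun i _ => ?_
      rw [add_right_comm κ (Pi.single i 1), add_right_comm (κ + Pi.single j 1)]

/-- The inequality is closed, so `v + ε` can be used and `ε` sent to 0. Zero weights are needed
because the direction used later is `Sum.elim 0 1`. -/
theorem hyperbolic_coeffHessian_iterate {v : ι → ℝ} (hv : ∀ i, 0 ≤ v i)
    {φ : (ι → ℕ) → ℝ} (hφ : ∀ α, 0 ≤ φ α) (hM : IsMConvex {α | 0 < φ α})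
    (hH : ∀ κ, (coeffHessian φ κ).Hyperbolic) (n : ℕ) (κ : ι → ℕ) :
    (coeffHessian ((dirDeriv v)^[n] φ) κ).Hyperbolic := by
  intro u x hu
  have hcont : ∀ n α, Continuous fun ε : ℝ => (dirDeriv (fun i => v i + ε))^[n] φ α := by
    intro n
    induction n with
    | zero => exact fun α => continuous_const
    | succ n ih =>
      intro α
      simp only [Function.iterate_succ_apply', dirDeriv]
      exact continuous_finsetSum _ fun i _ => (continuous_const.add continuous_id).mul (ih _)
  have hq : ∀ y z : ι → ℝ, Continuous fun ε : ℝ =>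
      y ⬝ᵥ coeffHessian ((dirDeriv (fun i => v i + ε))^[n] φ) κ *ᵥ z := fun y z =>
    continuous_finsetSum _ fun i _ => continuous_const.mul <|
      continuous_finsetSum _ fun j _ => (hcont n _).mul continuous_const
  have h := le_of_tendsto_of_tendsto (b := nhdsWithin (0 : ℝ) (Set.Ioi 0))
    ((((hq x x).mul (hq u u)).tendsto 0).mono_left nhdsWithin_le_nhds)
    ((((hq x u).pow 2).tendsto 0).mono_left nhdsWithin_le_nhds)
    (Filter.eventually_of_mem self_mem_nhdsWithin fun ε (hε : 0 < ε) =>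
      hyperbolic_coeffHessian_iterate_of_pos
        (fun i => add_pos_of_nonneg_of_pos (hv i) hε) hφ hM hH n κ u x hu)
  simpa only [add_zero, Pi.mul_apply, Pi.pow_apply] using h

open Classical in
/-- The derivatives of order `d - 2` of the generating function of an M-convex set. -/
theorem hyperbolic_coeffHessian_indicator {J : Set (ι → ℕ)} (hJ : IsMConvex J) (κ : ι → ℕ) :
    (coeffHessian (fun α => if α ∈ J then (1 : ℝ) else 0) κ).Hyperbolic := by
  set a : ι → ι → Prop := fun j k => κ + Pi.single j 1 + Pi.single k 1 ∈ J with ha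
  have hsymm : ∀ {j k}, a j k → a k j := fun {j k} h => by
    simpa only [ha, add_right_comm] using h
  -- This exchange makes non-adjacency transitive on the non-isolated indices `L`: the graph is
  -- complete multipartite, up to loops.
  have hexch : ∀ {j k l h}, a j l → a k h → a j k ∨ a k l := by
    intro j k l h hjl hkh
    by_cases hkj : k = j
    · exact Or.inr (hkj ▸ hjl)
    by_cases hkl : k = l
    · exact Or.inl (hkl ▸ hjl)
    obtain ⟨x, hx, hmem⟩ := hJ _ hjl _ hkh k (by
      simp only [Pi.add_apply, Pi.single_apply, if_neg hkj, if_neg hkl, if_true]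
      omega)
    by_cases hxj : x = j
    · right
      have : κ + Pi.single j 1 + Pi.single l 1 + Pi.single k 1 - Pi.single x 1 =
          κ + Pi.single k 1 + Pi.single l 1 := by
        funext y
        simp only [Pi.add_apply, Pi.sub_apply, hxj]
        omega
      rwa [this] at hmem
    · by_cases hxl : x = l
      · left
        have : κ + Pi.single j 1 + Pi.single l 1 + Pi.single k 1 - Pi.single x 1 =
            κ + Pi.single j 1 + Pi.single k 1 := by
          funext y
          simp only [Pi.add_apply, Pi.sub_apply, hxl]
          omega
        rwa [this] at hmem
      · simp [Pi.single_apply, hxj, hxl] at hx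
        omega
  set L : ι → Prop := fun j => ∃ k, a j k with hL
  set N : ι → ι → Prop := fun j k => L j ∧ L k ∧ ¬ a j k with hN
  have hNs : ∀ {j k}, N j k → N k j := fun {j k} h => ⟨h.2.1, h.1, fun h' => h.2.2 (hsymm h')⟩
  have hNt : ∀ {j k l}, N j k → N k l → N j l := fun {j k l} h h' =>
    ⟨h.1, h'.2.1, fun hjl => by
      obtain ⟨x, hx⟩ := h.2.1
      exact (hexch hjl hx).elim h.2.2 h'.2.2⟩
  set c : ι → ℝ := fun l => ((Finset.univ.filter fun k => N l k).card : ℝ) with hc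
  have hcN : ∀ {j k}, N j k → c j = c k := fun {j k} h => by
    simp only [hc]
    congr 2
    ext l
    simp only [Finset.mem_filter, Finset.mem_univ, true_and]
    exact ⟨hNt (hNs h), hNt h⟩
  -- Each class of `N` should contribute one square, but the sum over `l` repeats it once per
  -- member; the factors `√(c l)` compensate. The Hessian is then the square of the sum over `L`
  -- minus the squares of the class sums.
  have hkey : ∀ j k, ∑ l, (if N l j then (1 : ℝ) else 0) / √(c l) *
      ((if N l k then (1 : ℝ) else 0) / √(c l)) = if N j k then 1 else 0 := by
    intro j k
    by_cases hjk : N j k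
    · have h1 : ∀ l, (if N l j then (1 : ℝ) else 0) / √(c l) *
          ((if N l k then (1 : ℝ) else 0) / √(c l)) = if N j l then 1 / c j else 0 := by
        intro l
        by_cases hl : N l j
        · rw [if_pos hl, if_pos (hNt hl hjk), if_pos (hNs hl), hcN hl, div_mul_div_comm,
            Real.mul_self_sqrt (Nat.cast_nonneg _), one_mul]
        · rw [if_neg hl, if_neg fun h => hl (hNs h), zero_div, zero_mul]
      simp only [h1]
      rw [if_pos hjk, ← Finset.sum_filter, Finset.sum_const, nsmul_eq_mul]
      refine mul_one_div_cancel ?_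
      exact Nat.cast_ne_zero.2 (Finset.card_ne_zero_of_mem (a := k) (by simpa using hjk))
    · rw [if_neg hjk]
      refine Finset.sum_eq_zero fun l _ => ?_
      by_cases hl : N l j
      · rw [if_neg (c := N l k) fun h => hjk (hNt (hNs hl) h)]
        simp
      · simp [hl]
  have hA : ∀ j k, coeffHessian (fun α => if α ∈ J then (1 : ℝ) else 0) κ j k =
      (if L j then 1 else 0) * (if L k then 1 else 0) - if N j k then 1 else 0 := by
    intro j k
    change (if a j k then (1 : ℝ) else 0) = _
    by_cases h : a j k
    · simp [h, hN, show L j from ⟨k, h⟩, show L k from ⟨j, hsymm h⟩]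
    · by_cases hj : L j <;> by_cases hk : L k <;> simp [h, hN, hj, hk]
  refine Matrix.hyperbolic_of_eq_sq_sub (κ := ι) (fun j k => ?_)
    (fun x => ∑ j, (if L j then 1 else 0) * x j)
    (fun l x => ∑ j, (if N l j then (1 : ℝ) else 0) / √(c l) * x j) fun x y => ?_
  · simp only [coeffHessian, Matrix.of_apply]
    positivity
  · have h2 : ∑ l, (∑ j, (if N l j then (1 : ℝ) else 0) / √(c l) * x j) *
        (∑ j, (if N l j then (1 : ℝ) else 0) / √(c l) * y j) =
        ∑ j, ∑ k, (if N j k then 1 else 0) * (x j * y k) := by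
      have h3 : ∀ j k, (if N j k then (1 : ℝ) else 0) * (x j * y k) =
          ∑ l, (if N l j then (1 : ℝ) else 0) / √(c l) *
            ((if N l k then (1 : ℝ) else 0) / √(c l)) * (x j * y k) := fun j k => by
        rw [← hkey, Finset.sum_mul]
      simp only [Finset.sum_mul_sum, h3]
      rw [Finset.sum_comm]
      refine Finset.sum_congr rfl fun j _ => ?_
      rw [Finset.sum_comm]
      refine Finset.sum_congr rfl fun k _ => Finset.sum_congr rfl fun l _ => ?_
      ring
    rw [h2, Finset.sum_mul_sum, ← Finset.sum_sub_distrib]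
    simp only [dotProduct, Matrix.mulVec, hA, Finset.mul_sum, ← Finset.sum_sub_distrib]
    refine Finset.sum_congr rfl fun j _ => Finset.sum_congr rfl fun k _ => ?_
    ring

end

/-! ### Characteristic vectors and the exchange property of bases. -/

/-- The characteristic vector of a finite set. -/
def Finset.charVec {E : Type*} [DecidableEq E] (S : Finset E) : E → ℕ :=
  fun j => if j ∈ S then 1 else 0

theorem Finset.sum_charVec {E : Type*} [DecidableEq E] (S I : Finset E) :
    ∑ j ∈ I, S.charVec j = (I ∩ S).card := by
  simp [Finset.charVec]

theorem Finset.charVec_insert {E : Type*} [DecidableEq E] {S : Finset E} {j : E}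
    (hj : j ∉ S) :
    (insert j S).charVec = Pi.single j 1 + S.charVec := by
  funext x
  simp only [Finset.charVec, Finset.mem_insert, Pi.add_apply, Pi.single_apply]
  grind

section

variable {E : Type*} [Fintype E] [DecidableEq E]

namespace Polymatroid

/-- The lattice points of the base polytope. -/
def bases (P : Polymatroid E) : Set (E → ℕ) :=
  {b | (∀ I : Finset E, ∑ i ∈ I, b i ≤ P.rk I) ∧ ∑ i, b i = P.rank}

theorem cast_mem_basePolytope_iff (P : Polymatroid E) (b : E → ℕ) :
    (fun i => (b i : ℝ)) ∈ P.basePolytope ↔ b ∈ P.bases := by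
  simp only [basePolytope, bases, Set.mem_ofPred_eq]
  constructor
  · rintro ⟨-, h1, h2⟩
    exact ⟨fun I => by exact_mod_cast h2 I, by exact_mod_cast h1⟩
  · rintro ⟨h2, h1⟩
    exact ⟨fun i => Nat.cast_nonneg _, by exact_mod_cast h1, fun I => by exact_mod_cast h2 I⟩

theorem cast_mem_independencePolytope_iff (P : Polymatroid E) (b : E → ℕ) :
    (fun i => (b i : ℝ)) ∈ P.independencePolytope ↔ ∀ I : Finset E, ∑ i ∈ I, b i ≤ P.rk I := by
  simp only [independencePolytope, Set.mem_ofPred_eq]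
  constructor
  · rintro ⟨-, h2⟩
    exact fun I => by exact_mod_cast h2 I
  · intro h2
    exact ⟨fun i => Nat.cast_nonneg _, fun I => by exact_mod_cast h2 I⟩

/-- The sets on which an independent vector attains the rank form a lattice. -/
theorem sum_eq_rk_inter_union (P : Polymatroid E) {α : E → ℕ}
    (hα : ∀ I : Finset E, ∑ i ∈ I, α i ≤ P.rk I) {I J : Finset E}
    (hI : ∑ i ∈ I, α i = P.rk I) (hJ : ∑ i ∈ J, α i = P.rk J) :
    ∑ i ∈ I ∩ J, α i = P.rk (I ∩ J) ∧ ∑ i ∈ I ∪ J, α i = P.rk (I ∪ J) := by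
  have h1 := P.submodular I J
  have h2 := hα (I ∩ J)
  have h3 := hα (I ∪ J)
  have h4 := Finset.sum_union_inter (s₁ := I) (s₂ := J) (f := α)
  omega

/-- If every exchange fails, each `l` with `β l < α l` is excluded by an `α`-tight set containing
`k`. Tight sets are closed under intersection, so a minimal one `T` containing `k` excludes all such
`l`. Then `α ≤ β` on `T`, strictly at `k`, and `β` exceeds the rank of `T`. -/
theorem isMConvex_bases (P : Polymatroid E) : IsMConvex P.bases := by
  intro α hα β hβ k hk
  by_contra! hno
  have htight : ∀ l, β l < α l → ∃ I : Finset E, ∑ i ∈ I, α i = P.rk I ∧ k ∈ I ∧ l ∉ I := by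
    intro l hl
    have hlk : l ≠ k := by rintro rfl; omega
    have hsum : ∀ I : Finset E, ∑ i ∈ I, (α + Pi.single k 1 - Pi.single l 1 : E → ℕ) i +
        (if l ∈ I then 1 else 0) = ∑ i ∈ I, α i + if k ∈ I then 1 else 0 := by
      intro I
      have h1 : (α + Pi.single k 1 - Pi.single l 1) + Pi.single l 1 = α + Pi.single k 1 := by
        refine tsub_add_cancel_of_le fun x => ?_
        simp only [Pi.add_apply, Pi.single_apply]
        grind
      have h2 : ∑ i ∈ I, (α + Pi.single k 1 - Pi.single l 1 + Pi.single l 1 : E → ℕ) i =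
          ∑ i ∈ I, (α + Pi.single k 1 : E → ℕ) i := by rw [h1]
      simpa only [Pi.add_apply, Finset.sum_add_distrib, Finset.sum_pi_single'] using h2
    have hnot := hno l hl
    have huniv := hsum Finset.univ
    simp only [Finset.mem_univ, if_true] at huniv
    simp only [bases, Set.mem_ofPred_eq, not_and'] at hnot
    have := hnot (by have := hα.2; omega)
    push Not at this
    obtain ⟨I, hI⟩ := this
    have h1 := hsum I
    have h2 := hα.1 I
    refine ⟨I, ?_⟩
    split_ifs at h1 <;> first | omega | exact ⟨by omega, ‹_›, ‹_›⟩
  obtain ⟨T, hT, hmin⟩ := (Finset.univ.filter fun I : Finset E =>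
    ∑ i ∈ I, α i = P.rk I ∧ k ∈ I).exists_minimal ⟨Finset.univ,
      Finset.mem_filter.2 ⟨Finset.mem_univ _, hα.2, Finset.mem_univ k⟩⟩
  simp only [Finset.mem_filter, Finset.mem_univ, true_and] at hT hmin
  have hle : ∀ l ∈ T, α l ≤ β l := by
    intro l hl
    by_contra! hlt
    obtain ⟨I, hI, hkI, hlI⟩ := htight l hlt
    have h1 := (P.sum_eq_rk_inter_union hα.1 hT.1 hI).1
    have h2 := hmin ⟨h1, Finset.mem_inter.2 ⟨hT.2, hkI⟩⟩ Finset.inter_subset_left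
    exact hlI (Finset.mem_inter.1 (h2 hl)).2
  have := Finset.sum_lt_sum hle ⟨k, hT.2, hk⟩
  have := hβ.1 T
  omega

end Polymatroid

end

/-! ### Polarisation: splitting a base into two groups of variables. -/

section

variable {E : Type*} [DecidableEq E]

/-- The set of pairs `(b, c)` with `b + c ∈ B`, where `c` is the characteristic vector of a subset
of `F`. -/
def splitSet (B : Set (E → ℕ)) (F : Finset E) : Set (E ⊕ E → ℕ) :=
  {γ | (∀ j, γ (Sum.inr j) ≤ F.charVec j) ∧ (fun j => γ (Sum.inl j) + γ (Sum.inr j)) ∈ B}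

/-- If the total at the element under `k` must grow, an exchange in `B` is lifted to a copy of `l`
that decreases. Otherwise the other copy of the same element exceeds its target, and moving one unit
between the copies leaves the sum unchanged. -/
theorem isMConvex_splitSet {B : Set (E → ℕ)} (hB : IsMConvex B) (F : Finset E) :
    IsMConvex (splitSet B F) := by
  intro α hα β hβ k hk
  set p : E ⊕ E → E := Sum.elim id id with hp
  set a : E → ℕ := fun j => α (Sum.inl j) + α (Sum.inr j) with ha
  set b : E → ℕ := fun j => β (Sum.inl j) + β (Sum.inr j) with hb
  have hfin : ∀ l, β l < α l →
      (fun j => a j + (if j = p k then 1 else 0) - (if j = p l then 1 else 0)) ∈ B →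
      α + Pi.single k 1 - Pi.single l 1 ∈ splitSet B F := by
    intro l hl hmem
    refine ⟨fun j => ?_, ?_⟩
    · have h1 := hα.1 j
      have h2 := hβ.1 j
      simp only [Pi.add_apply, Pi.sub_apply, Pi.single_apply]
      grind
    · convert hmem using 1
      funext j
      simp only [Pi.add_apply, Pi.sub_apply, Pi.single_apply, ha, hp]
      rcases k with k | k <;> rcases l with l | l <;>
        simp only [Sum.elim_inl, Sum.elim_inr, Sum.inl.injEq, Sum.inr.injEq, reduceCtorEq,
          if_false, id] <;> grind
  by_cases hlt : a (p k) < b (p k)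
  · obtain ⟨l, hl, hmem⟩ := hB a hα.2 b hβ.2 (p k) hlt
    have hmem' : (fun j => a j + (if j = p k then 1 else 0) - (if j = l then 1 else 0)) ∈ B := by
      convert hmem using 1
      funext j
      simp only [Pi.add_apply, Pi.sub_apply, Pi.single_apply]
    rcases lt_or_ge (β (Sum.inl l)) (α (Sum.inl l)) with h | h
    · exact ⟨Sum.inl l, h, hfin _ h hmem'⟩
    · have h' : β (Sum.inr l) < α (Sum.inr l) := by simp only [ha, hb] at hl; omega
      exact ⟨Sum.inr l, h', hfin _ h' hmem'⟩
  · have hmem : ∀ l, p l = p k →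
        (fun j => a j + (if j = p k then 1 else 0) - (if j = p l then 1 else 0)) ∈ B := by
      intro l hl
      have h2 := hα.2
      simpa only [hl, Nat.add_sub_cancel] using h2
    rcases k with k | k
    · have h' : β (Sum.inr k) < α (Sum.inr k) := by
        simp only [hp, Sum.elim_inl, id, ha, hb] at hlt
        omega
      exact ⟨Sum.inr k, h', hfin _ h' (hmem _ rfl)⟩
    · have h' : β (Sum.inl k) < α (Sum.inl k) := by
        simp only [hp, Sum.elim_inr, id, ha, hb] at hlt
        omega
      exact ⟨Sum.inl k, h', hfin _ h' (hmem _ rfl)⟩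

end

section

variable {E : Type*} [Fintype E] [DecidableEq E]

theorem dirDeriv_sum_elim (ψ : (E ⊕ E → ℕ) → ℝ) (b c : E → ℕ) :
    dirDeriv (Sum.elim 0 1) ψ (Sum.elim b c) = ∑ j, ψ (Sum.elim b (c + Pi.single j 1)) := by
  have h : ∀ j, (Sum.elim b c + Pi.single (Sum.inr j) 1 : E ⊕ E → ℕ) =
      Sum.elim b (c + Pi.single j 1) := by
    intro j
    funext x
    rcases x with x | x <;> simp [Pi.single_apply]
  simp [dirDeriv, h]

/-- For a polynomial which is multiaffine in the second group of variables, iterated derivatives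
in the direction of the sum of those variables are sums over subsets. -/
theorem iterate_dirDeriv_sum_elim {φ : (E ⊕ E → ℕ) → ℝ}
    (hφ : ∀ γ : E ⊕ E → ℕ, (∃ j, 1 < γ (Sum.inr j)) → φ γ = 0) (n : ℕ) (b c : E → ℕ) :
    (dirDeriv (Sum.elim 0 1))^[n] φ (Sum.elim b c) =
      n.factorial * ∑ S ∈ Finset.univ.powersetCard n, φ (Sum.elim b (c + S.charVec)) := by
  induction n generalizing c with
  | zero =>
    have : (c + Finset.charVec (∅ : Finset E)) = c := by
      funext j; simp [Finset.charVec]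
    simp [this]
  | succ n ih =>
    rw [Function.iterate_succ_apply', dirDeriv_sum_elim]
    simp only [ih]
    rw [← Finset.mul_sum, Nat.factorial_succ, Nat.cast_mul, mul_comm ((n + 1 : ℕ) : ℝ), mul_assoc]
    congr 1
    have h1 : ∀ S ∈ (Finset.univ : Finset E).powersetCard (n + 1),
        ((n + 1 : ℕ) : ℝ) * φ (Sum.elim b (c + S.charVec)) =
        ∑ _j ∈ S, φ (Sum.elim b (c + S.charVec)) := by
      intro S hS
      rw [Finset.sum_const, (Finset.mem_powersetCard.1 hS).2, nsmul_eq_mul]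
    -- Terms with `j ∈ S` have exponent at least 2 in a multiaffine variable. The remaining pairs
    -- `(j, S)` produce each set of size `n + 1` once per element, whence the factor `n + 1`.
    have h2 : ∀ j, ∑ S ∈ (Finset.univ : Finset E).powersetCard n,
        φ (Sum.elim b (c + Pi.single j 1 + S.charVec)) =
        ∑ S ∈ ((Finset.univ : Finset E).powersetCard n).filter (j ∉ ·),
          φ (Sum.elim b (c + Pi.single j 1 + S.charVec)) := by
      intro j
      rw [Finset.sum_filter]
      refine Finset.sum_congr rfl fun S _ => ?_
      split_ifs with h
      · refine hφ _ ⟨j, ?_⟩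
        simp [Finset.charVec, h]
      · rfl
    simp only [h2]
    rw [Finset.mul_sum, Finset.sum_congr rfl h1, Finset.sum_sigma', Finset.sum_sigma']
    refine Finset.sum_bij' (fun x _ => ⟨insert x.1 x.2, x.1⟩) (fun x _ => ⟨x.2, x.1.erase x.2⟩)
      ?_ ?_ ?_ ?_ ?_
    · rintro ⟨j, S⟩ h
      simp only [Finset.mem_sigma, Finset.mem_filter, Finset.mem_powersetCard] at h ⊢
      simp [Finset.card_insert_of_notMem h.2.2, h.2.1.2]
    · rintro ⟨S, j⟩ h
      simp only [Finset.mem_sigma, Finset.mem_filter, Finset.mem_powersetCard] at h ⊢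
      simp [Finset.card_erase_of_mem h.2, h.1.2]
    · rintro ⟨j, S⟩ h
      simp only [Finset.mem_sigma, Finset.mem_filter, Finset.mem_powersetCard] at h
      simp [Finset.erase_insert h.2.2]
    · rintro ⟨S, j⟩ h
      simp only [Finset.mem_sigma, Finset.mem_powersetCard] at h
      simp [Finset.insert_erase h.2]
    · rintro ⟨j, S⟩ h
      simp only [Finset.mem_sigma, Finset.mem_filter] at h
      rw [Finset.charVec_insert h.2.2, add_assoc]

open Classical in
/-- The number of subsets `S` of `F` with `p` elements such that `b + 1_S` lies in `B`. -/
noncomputable def extensionCount (B : Set (E → ℕ)) (F : Finset E) (p : ℕ) (b : E → ℕ) : ℕ :=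
  ((F.powersetCard p).filter fun S => b + S.charVec ∈ B).card

open Classical in
theorem iterate_dirDeriv_indicator_splitSet (B : Set (E → ℕ)) (F : Finset E) (n : ℕ) (b : E → ℕ) :
    (dirDeriv (Sum.elim 0 1))^[n] (fun γ => if γ ∈ splitSet B F then (1 : ℝ) else 0)
      (Sum.elim b 0) = n.factorial * extensionCount B F n b := by
  rw [iterate_dirDeriv_sum_elim]
  · congr 1
    rw [← Finset.sum_filter_add_sum_filter_not _ (· ⊆ F)]
    rw [Finset.sum_eq_zero (s := Finset.filter (fun S => ¬ S ⊆ F) _), add_zero]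
    · rw [extensionCount, Finset.card_filter, Nat.cast_sum]
      refine Finset.sum_congr ?_ fun S hS => ?_
      · ext S
        simp [Finset.mem_powersetCard, and_comm]
      · have hSF := (Finset.mem_powersetCard.1 hS).1
        have h1 : (Sum.elim b (0 + S.charVec) ∈ splitSet B F) ↔ b + S.charVec ∈ B := by
          simp only [splitSet, Set.mem_ofPred_eq, Sum.elim_inl, Sum.elim_inr, zero_add]
          refine ⟨fun h => h.2, fun h => ⟨fun j => ?_, h⟩⟩
          simp only [Finset.charVec]
          split_ifs with h1 h2
          exacts [le_rfl, absurd (hSF h1) h2, Nat.zero_le _, le_rfl]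
        simp only [h1]
        split_ifs <;> simp
    · intro S hS
      rw [if_neg]
      rintro ⟨h1, -⟩
      refine (Finset.mem_filter.1 hS).2 fun j hj => ?_
      by_contra hjF
      have := h1 j
      simp [Finset.charVec, hj, hjF] at this
  · rintro γ ⟨j, hj⟩
    rw [if_neg]
    rintro ⟨h1, -⟩
    have := h1 j
    simp only [Finset.charVec] at this
    split_ifs at this <;> omega

end

theorem extensionCount_eq_zero {E : Type*} [Fintype E] [DecidableEq E] {B : Set (E → ℕ)}
    {F : Finset E} {p : ℕ} {b : E → ℕ}
    (h : ∀ S : Finset E, S ⊆ F → S.card = p → b + S.charVec ∉ B) : extensionCount B F p b = 0 := by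
  classical
  rw [extensionCount, Finset.card_eq_zero, Finset.filter_eq_empty_iff]
  exact fun S hS => h S (Finset.mem_powersetCard.1 hS).1 (Finset.mem_powersetCard.1 hS).2

/-! ### The closed formula for the coefficients. -/

namespace Polymatroid

variable {E : Type*} [Fintype E] [DecidableEq E]

theorem sum_add_card_of_mem_bases {P : Polymatroid E} {b : E → ℕ} {S : Finset E}
    (h : b + S.charVec ∈ P.bases) : ∑ j, b j + S.card = P.rank := by
  have := h.2
  simpa only [Pi.add_apply, Finset.sum_add_distrib, Finset.sum_charVec, Finset.univ_inter]
    using this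

-- A base has total `r`, which already forces the size of `S`. Dropping the size condition leaves an
-- alternating sum over all subsets of `F`.
open Classical in
theorem neg_one_pow_mul_extensionCount (P : Polymatroid E) (F : Finset E) (b : E → ℕ) :
    (-1 : ℤ) ^ (P.rank - ∑ j, b j) * extensionCount P.bases F (P.rank - ∑ j, b j) b =
      ∑ S ∈ F.powerset, if b + S.charVec ∈ P.bases then (-1 : ℤ) ^ S.card else 0 := by
  rw [← Finset.sum_filter, extensionCount, Finset.card_eq_sum_ones, Nat.cast_sum, Finset.mul_sum]
  refine Finset.sum_congr ?_ fun S hS => ?_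
  · ext S
    simp only [Finset.mem_filter, Finset.mem_powersetCard, Finset.mem_powerset]
    refine ⟨fun h => ⟨h.1.1, h.2⟩, fun h => ⟨⟨h.1, ?_⟩, h.2⟩⟩
    have := sum_add_card_of_mem_bases h.2
    omega
  · have := sum_add_card_of_mem_bases (Finset.mem_filter.1 hS).2
    rw [show S.card = P.rank - ∑ j, b j by omega]
    simp

/-- If one element has full rank, the alternating extension numbers satisfy the recursion that
defines `knutsonCoeff`. -/
theorem sum_Icc_extensionCount (P : Polymatroid E) {i : E} (hi : P.rk {i} = P.rank) {b : E → ℕ}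
    (hb : ∀ I : Finset E, ∑ j ∈ I, b j ≤ P.rk I) :
    ∑ b' ∈ Finset.Icc b P.cage, (-1 : ℤ) ^ (P.rank - ∑ j, b' j) *
      extensionCount P.bases (Finset.univ.erase i) (P.rank - ∑ j, b' j) b' = 1 := by
  classical
  set F := Finset.univ.erase i with hF
  simp only [neg_one_pow_mul_extensionCount]
  have hcage : ∀ a ∈ P.bases, a ≤ P.cage := fun a ha j => by
    simpa [cage] using ha.1 {j}
  -- Regrouping by the base `a = b' + 1_S`: the condition `b ≤ b'` becomes `b j < a j` on `S`. The
  -- inner alternating sum vanishes unless no such `j` exists in `F`.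
  have hswap : ∑ b' ∈ Finset.Icc b P.cage,
      ∑ S ∈ F.powerset, (if b' + S.charVec ∈ P.bases then (-1 : ℤ) ^ S.card else 0) =
      ∑ a ∈ (Finset.Icc b P.cage).filter (· ∈ P.bases),
        ∑ S ∈ (F.filter fun j => b j < a j).powerset, (-1 : ℤ) ^ S.card := by
    simp only [← Finset.sum_filter]
    rw [Finset.sum_sigma', Finset.sum_sigma']
    refine Finset.sum_bij' (fun x _ => ⟨x.1 + x.2.charVec, x.2⟩)
      (fun x _ => ⟨x.1 - x.2.charVec, x.2⟩) ?_ ?_ ?_ ?_ ?_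
    · rintro ⟨b', S⟩ h
      simp only [Finset.mem_sigma, Finset.mem_filter, Finset.mem_Icc, Finset.mem_powerset] at h ⊢
      refine ⟨⟨⟨h.1.1.trans le_self_add, hcage _ h.2.2⟩, h.2.2⟩, fun j hj => ?_⟩
      have : b j ≤ b' j := h.1.1 j
      refine Finset.mem_filter.2 ⟨h.2.1 hj, ?_⟩
      change b j < b' j + S.charVec j
      rw [Finset.charVec, if_pos hj]
      omega
    · rintro ⟨a, S⟩ h
      simp only [Finset.mem_sigma, Finset.mem_filter, Finset.mem_Icc, Finset.mem_powerset] at h ⊢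
      have hS : ∀ j ∈ S, b j < a j := fun j hj => (Finset.mem_filter.1 (h.2 hj)).2
      refine ⟨⟨fun j => ?_, tsub_le_self.trans h.1.1.2⟩,
        h.2.trans (Finset.filter_subset _ _), ?_⟩
      · have := h.1.1.1 j
        have := hS j
        simp only [Pi.sub_apply, Finset.charVec]
        split_ifs <;> grind
      · rw [tsub_add_cancel_of_le]
        · exact h.1.2
        · intro j
          have := hS j
          simp only [Finset.charVec]
          split_ifs <;> grind
    · rintro ⟨b', S⟩ h
      simp
    · rintro ⟨a, S⟩ h
      simp only [Finset.mem_sigma, Finset.mem_filter, Finset.mem_powerset] at h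
      have hS : ∀ j ∈ S, b j < a j := fun j hj => (Finset.mem_filter.1 (h.2 hj)).2
      simp only [Sigma.mk.injEq, heq_eq_eq, and_true]
      refine tsub_add_cancel_of_le fun j => ?_
      have := hS j
      simp only [Finset.charVec]
      split_ifs <;> grind
    · rintro ⟨b', S⟩ h
      rfl
  rw [hswap]
  simp only [Finset.sum_powerset_neg_one_pow_card]
  have hbr : ∑ j, b j ≤ P.rank := hb Finset.univ
  -- The unique base above `b` that agrees with `b` off `i`. It is a base because every set
  -- containing `i` has full rank.
  set a₀ : E → ℕ := b + Pi.single i (P.rank - ∑ j, b j) with ha₀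
  have hmem : a₀ ∈ P.bases := by
    refine ⟨fun I => ?_, ?_⟩
    · simp only [ha₀, Pi.add_apply, Finset.sum_add_distrib, Finset.sum_pi_single']
      split_ifs with h
      · have h1 := P.monotone {i} I (by simpa using h)
        have h2 : ∑ j ∈ I, b j ≤ ∑ j, b j :=
          Finset.sum_le_sum_of_subset (Finset.subset_univ I)
        omega
      · exact hb I
    · simp only [ha₀, Pi.add_apply, Finset.sum_add_distrib, Finset.sum_pi_single',
        Finset.mem_univ, if_true]
      omega
  rw [Finset.sum_eq_single a₀]
  · rw [if_pos]
    rw [Finset.filter_eq_empty_iff]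
    intro j hj
    simp [ha₀, (Finset.mem_erase.1 hj).1]
  · intro a ha hne
    rw [if_neg]
    intro hempty
    rw [Finset.filter_eq_empty_iff] at hempty
    simp only [Finset.mem_filter, Finset.mem_Icc] at ha
    have hj : ∀ j, j ≠ i → a j = b j := fun j hj =>
      le_antisymm (not_lt.1 (hempty (Finset.mem_erase.2 ⟨hj, Finset.mem_univ j⟩))) (ha.1.1 j)
    have h1 := ha.2.2
    have h2 := hmem.2
    rw [← Finset.add_sum_erase _ _ (Finset.mem_univ i)] at h1 h2
    have h3 : ∑ x ∈ Finset.univ.erase i, a x = ∑ x ∈ Finset.univ.erase i, a₀ x :=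
      Finset.sum_congr rfl fun x hx => by simp [ha₀, (Finset.mem_erase.1 hx).1, hj]
    refine hne (funext fun j => ?_)
    rcases eq_or_ne j i with rfl | hji
    · omega
    · simp [ha₀, hji, hj]
  · intro h
    exact absurd (Finset.mem_filter.2 ⟨Finset.mem_Icc.2 ⟨le_self_add, hcage _ hmem⟩, hmem⟩) h

/-- Induction on the corank `r - |b|`: isolating the term `b' = b` in `sum_Icc_extensionCount` gives
the defining recursion. -/
theorem knutsonCoeff_eq (P : Polymatroid E) {i : E} (hi : P.rk {i} = P.rank) (b : E → ℕ) :
    P.knutsonCoeff b = (-1 : ℤ) ^ (P.rank - ∑ j, b j) *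
      extensionCount P.bases (Finset.univ.erase i) (P.rank - ∑ j, b j) b := by
  classical
  induction hn : P.rank - ∑ j, b j using Nat.strong_induction_on generalizing b with
  | _ n ih =>
  subst hn
  rw [knutsonCoeff]
  split_ifs with h1 h2 h3 h4
  · rw [extensionCount_eq_zero, Nat.cast_zero, mul_zero]
    intro S _ _ hS
    have := sum_add_card_of_mem_bases hS
    omega
  · rw [cast_mem_basePolytope_iff] at h3
    rw [neg_one_pow_mul_extensionCount, Finset.sum_eq_single ∅]
    · have : b + Finset.charVec (∅ : Finset E) = b := by
        funext j; simp [Finset.charVec]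
      simp [this, h3]
    · intro S _ hS
      rw [if_neg]
      intro hmem
      have := sum_add_card_of_mem_bases hmem
      exact hS (Finset.card_eq_zero.1 (by omega))
    · simp
  · rw [cast_mem_basePolytope_iff] at h3
    rw [extensionCount_eq_zero, Nat.cast_zero, mul_zero]
    intro S _ hc hS
    have : S = ∅ := Finset.card_eq_zero.1 (by omega)
    subst this
    have hbS : b + Finset.charVec (∅ : Finset E) = b := by
      funext j; simp [Finset.charVec]
    exact h3 (hbS ▸ hS)
  · rw [cast_mem_independencePolytope_iff] at h4
    have hsum := P.sum_Icc_extensionCount hi h4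
    have hbc : b ≤ P.cage := fun j => by simpa [cage] using h4 {j}
    rw [← Finset.Ioc_insert_left hbc, Finset.sum_insert Finset.left_notMem_Ioc] at hsum
    rw [Finset.sum_attach _ fun b' => P.knutsonCoeff b', Finset.sum_congr rfl fun b' hb' => ?_,
      sub_eq_iff_eq_add]
    · exact hsum.symm
    · have hlt : b < b' := (Finset.mem_Ioc.1 hb').1
      obtain ⟨hle, j, hj⟩ := Pi.lt_def.1 hlt
      have hs : ∑ i, b i < ∑ i, b' i :=
        Finset.sum_lt_sum (fun i _ => hle i) ⟨j, Finset.mem_univ j, hj⟩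
      exact ih _ (by omega) b' rfl
  · rw [cast_mem_independencePolytope_iff] at h4
    rw [extensionCount_eq_zero, Nat.cast_zero, mul_zero]
    intro S _ _ hS
    refine h4 fun I => le_trans (Finset.sum_le_sum fun j _ => ?_) (hS.1 I)
    simp

/-- The sign of `c_b` cancels that of `(-t_0)^(r-|b|)`. No restriction on `κ` is needed, since the
count vanishes outside `I(P)` and in the wrong degree. -/
theorem coeff_gPoly {m : ℕ} (P : Polymatroid (Fin m)) {i : Fin m} (hi : P.rk {i} = P.rank)
    (κ : Fin (m + 1) →₀ ℕ) :
    P.gPoly.coeff κ =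
      extensionCount P.bases (Finset.univ.erase i) (κ 0) fun j => κ j.succ := by
  classical
  have hmon : ∀ k : Fin m → ℕ,
      C (P.knutsonCoeff k : ℝ) * (-X 0) ^ (P.rank - ∑ i, k i) * ∏ i, X i.succ ^ k i =
      monomial (Finsupp.equivFunOnFinite.symm
        (Fin.cons (P.rank - ∑ i, k i) k : Fin (m + 1) → ℕ))
        (extensionCount P.bases (Finset.univ.erase i) (P.rank - ∑ j, k j) k : ℝ) := by
    intro k
    rw [monomial_eq, Finsupp.prod_fintype _ _ (fun _ => pow_zero _), Fin.prod_univ_succ,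
      knutsonCoeff_eq P hi, neg_pow (X 0 : MvPolynomial (Fin (m + 1)) ℝ)]
    simp only [Finsupp.equivFunOnFinite_symm_apply_apply, Fin.cons_zero, Fin.cons_succ]
    have h1 : (C (((-1 : ℤ) ^ (P.rank - ∑ j, k j) *
        extensionCount P.bases (Finset.univ.erase i) (P.rank - ∑ j, k j) k : ℤ) : ℝ) :
          MvPolynomial (Fin (m + 1)) ℝ) = (-1) ^ (P.rank - ∑ j, k j) *
        C (extensionCount P.bases (Finset.univ.erase i) (P.rank - ∑ j, k j) k : ℝ) := by
      simp
    rw [h1]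
    have h2 : ((-1 : MvPolynomial (Fin (m + 1)) ℝ) ^ (P.rank - ∑ j, k j)) *
        (-1) ^ (P.rank - ∑ j, k j) = 1 := by
      rw [← mul_pow]; simp
    linear_combination (C (extensionCount P.bases (Finset.univ.erase i) (P.rank - ∑ j, k j) k : ℝ) *
      X 0 ^ (P.rank - ∑ j, k j) * ∏ i, X i.succ ^ k i) * h2
  set b : Fin m → ℕ := fun j => κ j.succ with hb
  have hκ : ∀ k : Fin m → ℕ, Finsupp.equivFunOnFinite.symm
        (Fin.cons (P.rank - ∑ i, k i) k : Fin (m + 1) → ℕ) = κ ↔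
      P.rank - ∑ i, k i = κ 0 ∧ k = b := by
    intro k
    rw [Equiv.symm_apply_eq]
    constructor
    · intro h
      exact ⟨by simpa using congrFun h 0, funext fun j => by simpa using congrFun h j.succ⟩
    · rintro ⟨h1, rfl⟩
      funext x
      refine Fin.cases ?_ (fun j => ?_) x
      · simpa using h1
      · simp [hb]
  rw [gPoly, coeff_sum]
  simp only [hmon, coeff_monomial, hκ]
  by_cases hmem : b ∈ P.independentPoints ∧ P.rank - ∑ i, b i = κ 0
  · rw [Finset.sum_eq_single_of_mem b hmem.1 fun k _ hk => if_neg fun h => hk h.2,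
      if_pos ⟨hmem.2, rfl⟩, hmem.2]
  · rw [Finset.sum_eq_zero, extensionCount_eq_zero, Nat.cast_zero]
    · intro S _ hc hS
      refine hmem ⟨?_, ?_⟩
      · rw [mem_independentPoints, cast_mem_independencePolytope_iff]
        exact fun I => le_trans (Finset.sum_le_sum fun j _ => by simp) (hS.1 I)
      · have := sum_add_card_of_mem_bases hS
        omega
    · intro k hk
      rw [if_neg]
      rintro ⟨h1, rfl⟩
      exact hmem ⟨hk, h1⟩

end Polymatroid

/-! ### The support as the bases of an extended polymatroid. -/

namespace Finset

variable {m : ℕ}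

/-- The preimage of a subset of `{0, …, m}` under `Fin.succ`. -/
def predPart (A : Finset (Fin (m + 1))) : Finset (Fin m) := univ.filter fun j => j.succ ∈ A

theorem predPart_inter (A B : Finset (Fin (m + 1))) :
    (A ∩ B).predPart = A.predPart ∩ B.predPart := by
  ext; simp [predPart]

theorem predPart_union (A B : Finset (Fin (m + 1))) :
    (A ∪ B).predPart = A.predPart ∪ B.predPart := by
  ext; simp [predPart]

theorem predPart_mono {A B : Finset (Fin (m + 1))} (h : A ⊆ B) : A.predPart ⊆ B.predPart :=
  fun j hj => by
    simp only [predPart, mem_filter, mem_univ, true_and] at hj ⊢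
    exact h hj

/-- The subset `F` if `0 ∈ A`, and the empty set otherwise. -/
def zeroPart (F : Finset (Fin m)) (A : Finset (Fin (m + 1))) : Finset (Fin m) :=
  if 0 ∈ A then F else ∅

theorem zeroPart_inter (F : Finset (Fin m)) (A B : Finset (Fin (m + 1))) :
    zeroPart F (A ∩ B) = zeroPart F A ∩ zeroPart F B := by
  simp only [zeroPart, mem_inter]
  split_ifs <;> simp_all

theorem zeroPart_union (F : Finset (Fin m)) (A B : Finset (Fin (m + 1))) :
    zeroPart F (A ∪ B) = zeroPart F A ∪ zeroPart F B := by
  simp only [zeroPart, mem_union]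
  split_ifs <;> simp_all

theorem zeroPart_mono (F : Finset (Fin m)) {A B : Finset (Fin (m + 1))} (h : A ⊆ B) :
    zeroPart F A ⊆ zeroPart F B := by
  simp only [zeroPart]
  split_ifs with h1 h2
  exacts [Subset.rfl, absurd (h h1) h2, empty_subset _, Subset.rfl]

theorem sum_eq_zero_add_sum_predPart (A : Finset (Fin (m + 1))) (κ : Fin (m + 1) → ℕ) :
    ∑ x ∈ A, κ x = (if 0 ∈ A then κ 0 else 0) + ∑ j ∈ A.predPart, κ j.succ := by
  rw [← univ_inter A, ← sum_ite_mem, Fin.sum_univ_succ, predPart, sum_filter]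
  simp

end Finset

namespace Polymatroid

open Finset

variable {m : ℕ}

/-- The rank function of the polymatroid on `{0, …, m}` obtained from a polymatroid on
`{1, …, m}` by adding one parallel element of rank at most one to each element of `F`, and merging
these into the new element `0`. -/
def extensionRk (P : Polymatroid (Fin m)) (F : Finset (Fin m)) (A : Finset (Fin (m + 1))) : ℕ :=
  (zeroPart F A).powerset.inf' ⟨∅, empty_mem_powerset _⟩ fun D =>
    P.rk (A.predPart ∪ D) + (zeroPart F A \ D).card

theorem extensionRk_le (P : Polymatroid (Fin m)) {F : Finset (Fin m)} {A : Finset (Fin (m + 1))}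
    {D : Finset (Fin m)} (hD : D ⊆ zeroPart F A) :
    P.extensionRk F A ≤ P.rk (A.predPart ∪ D) + (zeroPart F A \ D).card :=
  inf'_le _ (mem_powerset.2 hD)

theorem exists_extensionRk_eq (P : Polymatroid (Fin m)) (F : Finset (Fin m))
    (A : Finset (Fin (m + 1))) :
    ∃ D ⊆ zeroPart F A,
      P.extensionRk F A = P.rk (A.predPart ∪ D) + (zeroPart F A \ D).card := by
  obtain ⟨D, hD, h⟩ := exists_mem_eq_inf' (s := (zeroPart F A).powerset)
    ⟨∅, empty_mem_powerset _⟩ fun D => P.rk (A.predPart ∪ D) + (zeroPart F A \ D).card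
  exact ⟨D, mem_powerset.1 hD, h⟩

/-- The polymatroid with rank function `extensionRk`. -/
def extension (P : Polymatroid (Fin m)) (F : Finset (Fin m)) : Polymatroid (Fin (m + 1)) where
  rk := P.extensionRk F
  submodular A B := by
    obtain ⟨D, hD, hA⟩ := P.exists_extensionRk_eq F A
    obtain ⟨D', hD', hB⟩ := P.exists_extensionRk_eq F B
    -- The minimised expression is submodular jointly in `(A, D)`, so the intersection and union of
    -- the two minimisers are test sets for `A ∩ B` and `A ∪ B`.
    have h1 := P.extensionRk_le (A := A ∩ B) (D := D ∩ D')
      (by rw [zeroPart_inter]; exact inter_subset_inter hD hD')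
    have h2 := P.extensionRk_le (A := A ∪ B) (D := D ∪ D')
      (by rw [zeroPart_union]; exact union_subset_union hD hD')
    have h3 := P.submodular (A.predPart ∪ D) (B.predPart ∪ D')
    have h4 := P.monotone ((A ∩ B).predPart ∪ (D ∩ D'))
      ((A.predPart ∪ D) ∩ (B.predPart ∪ D')) (by
        rw [predPart_inter]
        intro x
        simp only [mem_union, mem_inter]
        tauto)
    have h5 : (A ∪ B).predPart ∪ (D ∪ D') = A.predPart ∪ D ∪ (B.predPart ∪ D') := by
      rw [predPart_union]
      ext x
      simp only [mem_union]
      tauto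
    rw [h5] at h2
    have h6 := card_sdiff_add_card_eq_card hD
    have h7 := card_sdiff_add_card_eq_card hD'
    have h8 : (zeroPart F (A ∩ B) \ (D ∩ D')).card + (D ∩ D').card =
        (zeroPart F A ∩ zeroPart F B).card := by
      rw [← zeroPart_inter, card_sdiff_add_card_eq_card]
      rw [zeroPart_inter]; exact inter_subset_inter hD hD'
    have h9 : (zeroPart F (A ∪ B) \ (D ∪ D')).card + (D ∪ D').card =
        (zeroPart F A ∪ zeroPart F B).card := by
      rw [← zeroPart_union, card_sdiff_add_card_eq_card]
      rw [zeroPart_union]; exact union_subset_union hD hD'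
    have h10 := card_union_add_card_inter D D'
    have h11 := card_union_add_card_inter (zeroPart F A) (zeroPart F B)
    omega
  monotone A B hAB := by
    obtain ⟨D, hD, hB⟩ := P.exists_extensionRk_eq F B
    have h1 := P.extensionRk_le (A := A) (D := zeroPart F A ∩ D) inter_subset_left
    have h2 := P.monotone (A.predPart ∪ (zeroPart F A ∩ D)) (B.predPart ∪ D)
      (union_subset_union (predPart_mono hAB) inter_subset_right)
    have h3 : (zeroPart F A \ (zeroPart F A ∩ D)).card ≤ (zeroPart F B \ D).card := by
      rw [sdiff_inter_self_left]
      exact card_le_card (sdiff_subset_sdiff (zeroPart_mono F hAB) Subset.rfl)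
    omega
  normalized := by
    have h := P.extensionRk_le (F := F) (A := ∅) (D := ∅) (empty_subset _)
    simpa [predPart, zeroPart, P.normalized] using h

theorem rank_extension (P : Polymatroid (Fin m)) (F : Finset (Fin m)) :
    (P.extension F).rank = P.rank := by
  have h0 : (univ : Finset (Fin (m + 1))).predPart = univ := by simp [predPart]
  have h1 : ∀ D, (univ : Finset (Fin (m + 1))).predPart ∪ D = univ := fun D => by
    rw [h0]; exact eq_univ_of_forall fun x => mem_union_left _ (mem_univ x)
  apply le_antisymm
  · have h := P.extensionRk_le (F := F) (A := univ) (D := zeroPart F univ) Subset.rfl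
    rw [h1, Finset.sdiff_self] at h
    exact h.trans_eq (by simp [rank])
  · obtain ⟨D, -, h⟩ := P.exists_extensionRk_eq F univ
    change P.rk univ ≤ P.extensionRk F univ
    rw [h, h1]
    exact Nat.le_add_right _ _

/-- A min-max argument. Take a maximal `S ⊆ F` of size at most `κ 0` with `b + 1_S` independent. If
it is too small, every element of `F \ S` lies in a tight set, and the union `T` of these is tight.
The rank bound at `{0} ∪ T`, with `D = F ∩ T`, then gives `κ 0 ≤ |T ∩ S| + |F \ T| ≤ |S|`, a
contradiction. -/
theorem mem_bases_extension_iff (P : Polymatroid (Fin m)) (F : Finset (Fin m))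
    (κ : Fin (m + 1) → ℕ) :
    κ ∈ (P.extension F).bases ↔
      ∃ S ⊆ F, S.card = κ 0 ∧ (fun j => κ j.succ) + S.charVec ∈ P.bases := by
  set b : Fin m → ℕ := fun j => κ j.succ with hb
  have hsum : ∀ (S I : Finset (Fin m)), ∑ j ∈ I, (b + S.charVec) j =
      ∑ j ∈ I, b j + (I ∩ S).card := fun S I => by
    simp only [Pi.add_apply, sum_add_distrib, sum_charVec]
  constructor
  · rintro ⟨h1, h2⟩
    rw [rank_extension, Fin.sum_univ_succ] at h2
    obtain ⟨S, hS, hmax⟩ := (univ.filter fun S : Finset (Fin m) =>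
      S ⊆ F ∧ S.card ≤ κ 0 ∧ ∀ I : Finset (Fin m), ∑ j ∈ I, (b + S.charVec) j ≤ P.rk I
      ).exists_maximal ⟨∅, by
        simp only [mem_filter, mem_univ, true_and, empty_subset, card_empty, Nat.zero_le, hsum,
          inter_empty, add_zero]
        intro I
        have h3 := h1 (I.map (Fin.succEmb m))
        have h4 := P.extensionRk_le (F := F) (A := I.map (Fin.succEmb m)) (empty_subset _)
        have h5 : (I.map (Fin.succEmb m)).predPart = I := by
          ext; simp [predPart]
        have h6 : (0 : Fin (m + 1)) ∉ I.map (Fin.succEmb m) := by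
          simp [Fin.succ_ne_zero]
        rw [h5, zeroPart, if_neg h6] at h4
        rw [sum_map] at h3
        simp only [union_empty, Finset.sdiff_self, card_empty, add_zero] at h4
        exact h3.trans h4⟩
    simp only [mem_filter, mem_univ, true_and] at hS hmax
    obtain ⟨hSF, hSc, hSI⟩ := hS
    have hcard : S.card = κ 0 := by
      by_contra hne
      have hlt : S.card < κ 0 := lt_of_le_of_ne hSc hne
      obtain ⟨T, hT, hTF⟩ : ∃ T : Finset (Fin m),
          ∑ j ∈ T, (b + S.charVec) j = P.rk T ∧ F \ S ⊆ T := by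
        have haux : ∀ G : Finset (Fin m), G ⊆ F \ S → ∃ T : Finset (Fin m),
            ∑ j ∈ T, (b + S.charVec) j = P.rk T ∧ G ⊆ T := by
          intro G
          induction G using Finset.induction_on with
          | empty => exact fun _ => ⟨∅, by simp [P.normalized], Subset.rfl⟩
          | insert j G _ ih =>
            intro hG
            obtain ⟨T, hT, hGT⟩ := ih ((subset_insert _ _).trans hG)
            have hj := mem_sdiff.1 (hG (mem_insert_self j G))
            obtain ⟨T', hT', hjT'⟩ : ∃ T' : Finset (Fin m),
                ∑ x ∈ T', (b + S.charVec) x = P.rk T' ∧ j ∈ T' := by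
              by_contra! hno
              have hbig : insert j S ⊆ F ∧ (insert j S).card ≤ κ 0 ∧
                  ∀ I : Finset (Fin m), ∑ x ∈ I, (b + (insert j S).charVec) x ≤ P.rk I := by
                refine ⟨insert_subset hj.1 hSF, ?_, fun I => ?_⟩
                · rw [card_insert_of_notMem hj.2]; exact hlt
                · have h3 : ∑ x ∈ I, (b + (insert j S).charVec) x =
                      ∑ x ∈ I, (b + S.charVec) x + if j ∈ I then 1 else 0 := by
                    rw [charVec_insert hj.2]
                    simp only [Pi.add_apply, sum_add_distrib, sum_pi_single']
                    ring
                  rw [h3]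
                  have h4 := hSI I
                  have h5 := fun h => hno I h
                  split_ifs with hjI
                  · by_contra! hlt'
                    exact h5 (by omega) hjI
                  · exact h4
              exact hj.2 (hmax hbig (subset_insert _ _) (mem_insert_self _ _))
            refine ⟨T' ∪ T, (P.sum_eq_rk_inter_union hSI hT' hT).2, ?_⟩
            exact insert_subset (mem_union_left _ hjT') (hGT.trans subset_union_right)
        exact haux _ Subset.rfl
      set A : Finset (Fin (m + 1)) := insert 0 (T.map (Fin.succEmb m)) with hA
      have hAT : A.predPart = T := by
        ext; simp [predPart, hA, Fin.succ_ne_zero]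
      have hA0 : zeroPart F A = F := if_pos (mem_insert_self _ _)
      have h3 := h1 A
      rw [sum_eq_zero_add_sum_predPart, hAT, if_pos (mem_insert_self _ _)] at h3
      have h4 := P.extensionRk_le (F := F) (A := A) (D := F ∩ T)
        (by rw [hA0]; exact inter_subset_left)
      rw [hAT, hA0, union_eq_left.2 inter_subset_right, sdiff_inter_self_left, ← hT, hsum] at h4
      have h5 : (T ∩ S).card + (F \ T).card ≤ S.card := by
        rw [← card_union_of_disjoint
          (disjoint_sdiff.mono_left inter_subset_left)]
        refine card_le_card (union_subset inter_subset_right fun x hx => ?_)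
        by_contra hxS
        exact (mem_sdiff.1 hx).2 (hTF (mem_sdiff.2 ⟨(mem_sdiff.1 hx).1, hxS⟩))
      have h6 : κ 0 + ∑ j ∈ T, b j ≤ P.extensionRk F A := h3
      omega
    refine ⟨S, hSF, hcard, hSI, ?_⟩
    rw [hsum, univ_inter, hcard]
    simp only [hb]
    omega
  · rintro ⟨S, hSF, hSc, hS⟩
    have hrank := sum_add_card_of_mem_bases hS
    refine ⟨fun A => ?_, ?_⟩
    · obtain ⟨D, hD, h⟩ := P.exists_extensionRk_eq F A
      change _ ≤ P.extensionRk F A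
      rw [h, sum_eq_zero_add_sum_predPart]
      have h1 := hS.1 (A.predPart ∪ D)
      rw [hsum] at h1
      have h2 : ∑ j ∈ A.predPart, b j ≤ ∑ j ∈ A.predPart ∪ D, b j :=
        sum_le_sum_of_subset subset_union_left
      change (if 0 ∈ A then κ 0 else 0) + ∑ j ∈ A.predPart, b j ≤ _
      split_ifs with h0
      · rw [zeroPart, if_pos h0] at hD ⊢
        have h3 : S.card ≤ ((A.predPart ∪ D) ∩ S).card + (F \ D).card := by
          refine le_trans (card_le_card fun x hx => ?_) (card_union_le _ _)
          simp only [mem_union, mem_inter, mem_sdiff]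
          have := hSF hx
          tauto
        omega
      · omega
    · rw [rank_extension, Fin.sum_univ_succ]
      change κ 0 + ∑ j, b j = _
      omega

theorem extensionCount_ne_zero_iff (P : Polymatroid (Fin m)) (F : Finset (Fin m))
    (κ : Fin (m + 1) → ℕ) :
    extensionCount P.bases F (κ 0) (fun j => κ j.succ) ≠ 0 ↔ κ ∈ (P.extension F).bases := by
  classical
  rw [mem_bases_extension_iff, extensionCount, card_ne_zero]
  simp only [Finset.Nonempty, mem_filter, mem_powersetCard, and_assoc]

end Polymatroid

/-! ### Counting positive eigenvalues, and derivatives in terms of coefficients. -/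

namespace Matrix

variable {ι : Type*} [Fintype ι]

/-- Some nontrivial combination is `A`-orthogonal to the all-ones vector, where reverse
Cauchy-Schwarz gives the sign. Requiring only `(s, t) ≠ 0` lets the conclusion pull back along
linear maps that need not be injective. -/
theorem Hyperbolic.exists_nonpos {A : Matrix ι ι ℝ} (hA : A.Hyperbolic) (h0 : ∀ i j, 0 ≤ A i j)
    (x y : ι → ℝ) :
    ∃ s t : ℝ, (s ≠ 0 ∨ t ≠ 0) ∧ (s • x + t • y) ⬝ᵥ A *ᵥ (s • x + t • y) ≤ 0 := by
  set u : ι → ℝ := fun _ => 1 with hu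
  have hu0 : ∀ i, 0 ≤ u i := fun _ => zero_le_one
  rcases (dotProduct_mulVec_nonneg h0 hu0 hu0).eq_or_lt with hz | hpos
  · have hA0 : A = 0 := by
      have h1 : ∑ i, ∑ j, A i j = 0 := by simpa [hu, dotProduct, mulVec] using hz.symm
      ext i j
      have h2 := (Finset.sum_eq_zero_iff_of_nonneg fun i _ =>
        Finset.sum_nonneg fun j _ => h0 i j).1 h1 i (Finset.mem_univ i)
      exact (Finset.sum_eq_zero_iff_of_nonneg fun j _ => h0 i j).1 h2 j (Finset.mem_univ j)
    exact ⟨1, 0, Or.inl one_ne_zero, by simp [hA0]⟩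
  · have key : ∀ z : ι → ℝ, z ⬝ᵥ A *ᵥ u = 0 → z ⬝ᵥ A *ᵥ z ≤ 0 := fun z hz => by
      have h := hA u z hu0
      rw [hz, zero_pow two_ne_zero] at h
      exact nonpos_of_mul_nonpos_left h hpos
    by_cases hy : y ⬝ᵥ A *ᵥ u = 0
    · exact ⟨0, 1, Or.inr one_ne_zero, key _ (by simpa using hy)⟩
    · refine ⟨y ⬝ᵥ A *ᵥ u, -(x ⬝ᵥ A *ᵥ u), Or.inl hy, key _ ?_⟩
      rw [add_dotProduct, smul_dotProduct, smul_dotProduct]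
      simp only [smul_eq_mul]
      ring

/-- Two eigenvectors with positive eigenvalues would span a plane on which the form is positive
definite. -/
theorem IsHermitian.ncard_pos_eigenvalues_le_one [DecidableEq ι] {H : Matrix ι ι ℝ}
    (hH : H.IsHermitian)
    (h : ∀ x y : ι → ℝ, ∃ s t : ℝ, (s ≠ 0 ∨ t ≠ 0) ∧
      (s • x + t • y) ⬝ᵥ H *ᵥ (s • x + t • y) ≤ 0) :
    {i | 0 < hH.eigenvalues i}.ncard ≤ 1 := by
  rw [Set.ncard_le_one_iff (Set.toFinite _)]
  intro a b ha hb
  by_contra hab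
  obtain ⟨s, t, hst, hle⟩ := h (⇑(hH.eigenvectorBasis a)) (⇑(hH.eigenvectorBasis b))
  have horth : ∀ i j, ⇑(hH.eigenvectorBasis i) ⬝ᵥ ⇑(hH.eigenvectorBasis j) =
      if i = j then (1 : ℝ) else 0 := fun i j => by
    have h1 := orthonormal_iff_ite.1 hH.eigenvectorBasis.orthonormal i j
    rw [EuclideanSpace.inner_eq_star_dotProduct, star_trivial, dotProduct_comm] at h1
    exact h1
  simp only [mulVec_add, mulVec_smul, hH.mulVec_eigenvectorBasis, add_dotProduct, dotProduct_add,
    smul_dotProduct, dotProduct_smul, horth, hab, Ne.symm hab, if_true, if_false,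
    smul_eq_mul, mul_one, mul_zero, add_zero, zero_add] at hle
  have ha' : 0 < hH.eigenvalues a := ha
  have hb' : 0 < hH.eigenvalues b := hb
  have h1 : 0 ≤ s * (s * hH.eigenvalues a) := by nlinarith [mul_self_nonneg s]
  have h2 : 0 ≤ t * (t * hH.eigenvalues b) := by nlinarith [mul_self_nonneg t]
  rcases hst with hs | ht
  · have : 0 < s * (s * hH.eigenvalues a) := by
      rw [← mul_assoc]; exact mul_pos (mul_self_pos.2 hs) ha'
    linarith
  · have : 0 < t * (t * hH.eigenvalues b) := by
      rw [← mul_assoc]; exact mul_pos (mul_self_pos.2 ht) hb'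
    linarith

end Matrix

namespace MvPolynomial

variable {σ : Type*} [Fintype σ]

theorem coeff_normalization (f : MvPolynomial σ ℝ) (k : σ →₀ ℕ) :
    (normalization f).coeff k = f.coeff k / (∏ i, (k i).factorial : ℕ) := by
  classical
  rw [normalization, coeff_sum]
  simp only [coeff_monomial]
  rw [Finset.sum_ite_eq' f.support k]
  split_ifs with h
  · rfl
  · rw [notMem_support_iff.1 h, zero_div]

/-- In the basis `t^k / k!` differentiation is a shift of exponents, so Hessian entries of
derivatives of `N(f)` are plain coefficients of `f`. -/
theorem coeff_iterPDeriv_mul (f : MvPolynomial σ ℝ) (l : List σ) (k : σ →₀ ℕ) :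
    (iterPDeriv l f).coeff k * (∏ i, (k i).factorial : ℕ) =
      f.coeff (k + (l.map fun i => Finsupp.single i 1).sum) *
        (∏ i, ((k + (l.map fun i => Finsupp.single i 1).sum : σ →₀ ℕ) i).factorial : ℕ) := by
  classical
  induction l generalizing k with
  | nil => simp [iterPDeriv]
  | cons i l ih =>
    have h1 : (∏ j, ((k + Finsupp.single i 1 : σ →₀ ℕ) j).factorial) =
        (k i + 1) * ∏ j, (k j).factorial := by
      rw [← Finset.mul_prod_erase _ _ (Finset.mem_univ i),
        ← Finset.mul_prod_erase _ (fun j => (k j).factorial) (Finset.mem_univ i), ← mul_assoc]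
      congr 1
      · simp [Nat.factorial_succ]
      · refine Finset.prod_congr rfl fun j hj => ?_
        simp [(Finset.mem_erase.1 hj).1.symm]
    have h2 := ih (k + Finsupp.single i 1)
    rw [h1] at h2
    rw [List.map_cons, List.sum_cons, ← add_assoc, ← h2]
    change (pderiv i (iterPDeriv l f)).coeff k * _ = _
    rw [coeff_pderiv]
    push_cast
    ring

theorem constantCoeff_iterPDeriv_normalization (f : MvPolynomial σ ℝ) (l : List σ) :
    constantCoeff (iterPDeriv l (normalization f)) =
      f.coeff (l.map fun i => Finsupp.single i 1).sum := by
  have h := coeff_iterPDeriv_mul (normalization f) l 0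
  have h0 : ((∏ i, ((l.map fun i => Finsupp.single i 1).sum i).factorial : ℕ) : ℝ) ≠ 0 :=
    Nat.cast_ne_zero.2 (Finset.prod_ne_zero_iff.2 fun i _ => Nat.factorial_ne_zero _)
  rw [zero_add, coeff_normalization, div_mul_cancel₀ _ h0] at h
  rw [constantCoeff_eq, ← h]
  simp

end MvPolynomial

/-! ### Comparison of Hessians and the conclusion. -/

section

variable {m : ℕ} {B : Set (Fin m → ℕ)}

-- Here `H` is the Hessian of a derivative of `N(g_P)`. Its form, times `p!`, is bounded above by
-- the pullback of the hyperbolic form `A` of the split set, so a combination on which the latter is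
-- nonpositive serves for `H`.
open Classical in
theorem exists_nonpos_of_extensionCount (hB : IsMConvex B) (F : Finset (Fin m)) (p : ℕ)
    (b : Fin m → ℕ) {H : Matrix (Fin (m + 1)) (Fin (m + 1)) ℝ}
    (h00 : H 0 0 = extensionCount B F (p + 2) b)
    (h01 : ∀ j, H 0 j.succ = extensionCount B F (p + 1) (b + Pi.single j 1))
    (h10 : ∀ j, H j.succ 0 = extensionCount B F (p + 1) (b + Pi.single j 1))
    (h11 : ∀ j k, H j.succ k.succ = extensionCount B F p (b + Pi.single j 1 + Pi.single k 1))
    (x y : Fin (m + 1) → ℝ) :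
    ∃ s t : ℝ, (s ≠ 0 ∨ t ≠ 0) ∧ (s • x + t • y) ⬝ᵥ H *ᵥ (s • x + t • y) ≤ 0 := by
  set φ : (Fin m ⊕ Fin m → ℕ) → ℝ := fun γ => if γ ∈ splitSet B F then 1 else 0 with hφ
  have hsupp : {γ | 0 < φ γ} = splitSet B F := by
    ext γ
    by_cases h : γ ∈ splitSet B F <;> simp [hφ, h]
  set A := coeffHessian ((dirDeriv (Sum.elim 0 1))^[p] φ) (Sum.elim b 0) with hAdef
  have hA : A.Hyperbolic := hyperbolic_coeffHessian_iterate (φ := φ)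
    (fun i => by rcases i with i | i <;> simp) (fun γ => by simp only [hφ]; positivity)
    (by rw [hsupp]; exact isMConvex_splitSet hB F)
    (hyperbolic_coeffHessian_indicator (isMConvex_splitSet hB F)) p _
  have hAs : A.IsSymm := Matrix.IsSymm.ext fun i j => by
    simp only [hAdef, coeffHessian, Matrix.of_apply, add_right_comm]
  -- The scaling `1/(p+1)` turns the factor `(p+1)!` of the mixed entries into `p!`, matching the
  -- entries without `t_0`.
  set U : (Fin (m + 1) → ℝ) → (Fin m ⊕ Fin m → ℝ) := fun z =>
    Sum.elim (fun j => z j.succ) (fun _ => z 0 / (p + 1)) with hU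
  have hUadd : ∀ s t : ℝ, U (s • x + t • y) = s • U x + t • U y := fun s t => by
    funext i
    rcases i with i | i
    · simp [hU]
    · simp [hU]; ring
  obtain ⟨s, t, hst, hle⟩ := hA.exists_nonpos
    (fun i j => iterate_dirDeriv_nonneg (fun i => by rcases i with i | i <;> simp)
      (fun γ => by simp only [hφ]; positivity) p _) (U x) (U y)
  refine ⟨s, t, hst, ?_⟩
  rw [← hUadd] at hle
  generalize s • x + t • y = z at hle
  have hcount := fun n b => iterate_dirDeriv_indicator_splitSet B F n b
  have hll : ∀ j k, A (Sum.inl j) (Sum.inl k) =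
      p.factorial * extensionCount B F p (b + Pi.single j 1 + Pi.single k 1) := fun j k => by
    rw [← hcount]
    simp only [hAdef, coeffHessian, Matrix.of_apply]
    refine congrArg ((dirDeriv (Sum.elim 0 1))^[p] φ) (funext fun i => ?_)
    rcases i with i | i <;> simp [Pi.single_apply]
  have hlr : ∀ j, ∑ k, A (Sum.inl j) (Sum.inr k) =
      (p + 1).factorial * extensionCount B F (p + 1) (b + Pi.single j 1) := fun j => by
    rw [← hcount, Function.iterate_succ_apply', dirDeriv_sum_elim]
    simp only [hAdef, coeffHessian, Matrix.of_apply]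
    refine Finset.sum_congr rfl fun k _ => ?_
    refine congrArg ((dirDeriv (Sum.elim 0 1))^[p] φ) (funext fun i => ?_)
    rcases i with i | i <;> simp [Pi.single_apply]
  have hrr : ∑ j, ∑ k, A (Sum.inr j) (Sum.inr k) =
      (p + 2).factorial * extensionCount B F (p + 2) b := by
    rw [← hcount, Function.iterate_succ_apply', dirDeriv_sum_elim]
    refine Finset.sum_congr rfl fun j _ => ?_
    rw [Function.iterate_succ_apply', dirDeriv_sum_elim]
    simp only [hAdef, coeffHessian, Matrix.of_apply]
    refine Finset.sum_congr rfl fun k _ => ?_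
    refine congrArg ((dirDeriv (Sum.elim 0 1))^[p] φ) (funext fun i => ?_)
    rcases i with i | i <;> simp [Pi.single_apply]
  have hf : (0 : ℝ) < p.factorial := by positivity
  have hQA : U z ⬝ᵥ A *ᵥ U z =
      ∑ j, ∑ k, z j.succ * (A (Sum.inl j) (Sum.inl k) * z k.succ)
        + (∑ j, z j.succ * (z 0 / (p + 1)) * ∑ k, A (Sum.inl j) (Sum.inr k)
          + ∑ j, z j.succ * (z 0 / (p + 1)) * ∑ k, A (Sum.inl j) (Sum.inr k))
        + (z 0 / (p + 1)) ^ 2 * ∑ j, ∑ k, A (Sum.inr j) (Sum.inr k) := by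
    have h1 : ∑ j, z 0 / (p + 1) * ∑ k, (A (Sum.inr j) (Sum.inl k) * z k.succ) =
        ∑ j, z j.succ * (z 0 / (p + 1)) * ∑ k, A (Sum.inl j) (Sum.inr k) := by
      simp only [Finset.mul_sum]
      rw [Finset.sum_comm]
      refine Finset.sum_congr rfl fun j _ => Finset.sum_congr rfl fun k _ => ?_
      rw [hAs.apply]; ring
    have h2 : ∑ j, z j.succ * ∑ k, (A (Sum.inl j) (Sum.inr k) * (z 0 / (p + 1))) =
        ∑ j, z j.succ * (z 0 / (p + 1)) * ∑ k, A (Sum.inl j) (Sum.inr k) := by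
      simp only [Finset.mul_sum]
      refine Finset.sum_congr rfl fun j _ => Finset.sum_congr rfl fun k _ => ?_
      ring
    have h3 : ∑ j, z 0 / (p + 1) * ∑ k, (A (Sum.inr j) (Sum.inr k) * (z 0 / (p + 1))) =
        (z 0 / (p + 1)) ^ 2 * ∑ j, ∑ k, A (Sum.inr j) (Sum.inr k) := by
      simp only [Finset.mul_sum]
      refine Finset.sum_congr rfl fun j _ => Finset.sum_congr rfl fun k _ => ?_
      ring
    simp only [dotProduct, Matrix.mulVec, Fintype.sum_sum_type, hU, Sum.elim_inl, Sum.elim_inr,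
      mul_add, Finset.sum_add_distrib, h1, h2, h3]
    simp only [Finset.mul_sum]
    ring
  have hQH : z ⬝ᵥ H *ᵥ z =
      ∑ j : Fin m, ∑ k : Fin m, z j.succ * (H j.succ k.succ * z k.succ)
        + (∑ j : Fin m, z j.succ * z 0 * H j.succ 0 +
          ∑ j : Fin m, z j.succ * z 0 * H j.succ 0) + z 0 ^ 2 * H 0 0 := by
    have h1 : z 0 * ∑ j : Fin m, H 0 j.succ * z j.succ =
        ∑ j : Fin m, z j.succ * z 0 * H j.succ 0 := by
      rw [Finset.mul_sum]
      exact Finset.sum_congr rfl fun j _ => by rw [h01, h10]; ring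
    have h2 : ∑ j : Fin m, z j.succ * (H j.succ 0 * z 0) =
        ∑ j : Fin m, z j.succ * z 0 * H j.succ 0 :=
      Finset.sum_congr rfl fun j _ => by ring
    simp only [dotProduct, Matrix.mulVec, Fin.sum_univ_succ, mul_add, Finset.sum_add_distrib,
      h1, h2]
    simp only [Finset.mul_sum]
    ring
  have hcmp : p.factorial * (z ⬝ᵥ H *ᵥ z) ≤ U z ⬝ᵥ A *ᵥ U z := by
    rw [hQA, hQH, hrr, h00]
    simp only [hll, hlr, h10, h11]
    have e1 : ∑ j : Fin m, z j.succ * (z 0 / (p + 1)) * (((p + 1).factorial : ℝ) *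
          extensionCount B F (p + 1) (b + Pi.single j 1)) =
        p.factorial * ∑ j : Fin m, z j.succ * z 0 *
          (extensionCount B F (p + 1) (b + Pi.single j 1) : ℝ) := by
      rw [Finset.mul_sum]
      refine Finset.sum_congr rfl fun j _ => ?_
      rw [Nat.factorial_succ]
      push_cast
      field_simp
    have e2 : ∑ j : Fin m, ∑ k : Fin m, z j.succ * (p.factorial *
          (extensionCount B F p (b + Pi.single j 1 + Pi.single k 1) : ℝ) * z k.succ) =
        p.factorial * ∑ j : Fin m, ∑ k : Fin m, z j.succ *
          ((extensionCount B F p (b + Pi.single j 1 + Pi.single k 1) : ℝ) * z k.succ) := by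
      simp only [Finset.mul_sum]
      refine Finset.sum_congr rfl fun j _ => Finset.sum_congr rfl fun k _ => ?_
      ring
    -- The only loss: `(p+2)! / (p+1)² = p! (1 + 1/(p+1))` is at least `p!`.
    have e3 : p.factorial * (z 0 ^ 2 * (extensionCount B F (p + 2) b : ℝ)) ≤
        (z 0 / (p + 1)) ^ 2 * (((p + 2).factorial : ℝ) * extensionCount B F (p + 2) b) := by
      have : (z 0 / (p + 1)) ^ 2 * (((p + 2).factorial : ℝ) * extensionCount B F (p + 2) b) =
          p.factorial * (z 0 ^ 2 * (extensionCount B F (p + 2) b : ℝ)) +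
          p.factorial * (z 0 ^ 2 * (extensionCount B F (p + 2) b : ℝ)) / (p + 1) := by
        rw [Nat.factorial_succ, Nat.factorial_succ]
        push_cast
        field_simp
      rw [this]
      exact le_add_of_nonneg_right (by positivity)
    rw [e1, e2]
    linarith
  exact nonpos_of_mul_nonpos_right (hcmp.trans hle) hf

end

theorem Polymatroid.isLorentzian_normalization_gPoly {m : ℕ} (P : Polymatroid (Fin m))
    {i : Fin m} (hi : P.rk {i} = P.rank) : IsLorentzian P.rank (normalization P.gPoly) := by
  have hfac : ∀ k : Fin (m + 1) →₀ ℕ, (0 : ℝ) < (∏ i, (k i).factorial : ℕ) := fun k =>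
    Nat.cast_pos.2 (Finset.prod_pos fun i _ => Nat.factorial_pos _)
  have hpos : ∀ k, 0 < (normalization P.gPoly).coeff k ↔
      ⇑k ∈ (P.extension (Finset.univ.erase i)).bases := fun k => by
    rw [coeff_normalization, div_pos_iff_of_pos_right (hfac k), P.coeff_gPoly hi, Nat.cast_pos,
      Nat.pos_iff_ne_zero, extensionCount_ne_zero_iff]
  have hnn : ∀ k, 0 ≤ (normalization P.gPoly).coeff k := fun k => by
    rw [coeff_normalization, P.coeff_gPoly hi]
    positivity
  refine ⟨fun k hk => ?_, hnn, ⟨P.extension (Finset.univ.erase i), ?_⟩, fun l hl => ?_⟩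
  · have h := ((hpos k).1 (lt_of_le_of_ne (hnn k) hk.symm)).2
    rw [Polymatroid.rank_extension] at h
    rw [← h, ← Finsupp.degree_eq_sum, Finsupp.degree_eq_weight_one]
    rfl
  · ext k
    rw [Set.mem_ofPred_eq, Set.mem_ofPred_eq, hpos, cast_mem_basePolytope_iff]
  · refine Matrix.IsHermitian.ncard_pos_eigenvalues_le_one _ ?_
    set κ : Fin (m + 1) →₀ ℕ := (l.map fun i => Finsupp.single i 1).sum with hκ
    have hH : ∀ j k, hessianMatrix (iterPDeriv l (normalization P.gPoly)) j k =
        extensionCount P.bases (Finset.univ.erase i)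
          ((Finsupp.single j 1 + (Finsupp.single k 1 + κ) : Fin (m + 1) →₀ ℕ) 0)
          fun x => (Finsupp.single j 1 + (Finsupp.single k 1 + κ) : Fin (m + 1) →₀ ℕ) x.succ := fun j k => by
      rw [← P.coeff_gPoly hi]
      exact constantCoeff_iterPDeriv_normalization P.gPoly (j :: k :: l)
    refine exists_nonpos_of_extensionCount P.isMConvex_bases (Finset.univ.erase i) (κ 0)
      (fun x => κ x.succ) ?_ (fun j => ?_) (fun j => ?_) (fun j k => ?_)
    all_goals
      rw [hH]
      congr 2
      · simp [Fin.succ_ne_zero]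
        try omega
      · funext x
        simp [Finsupp.single_apply, Pi.single_apply, Fin.succ_ne_zero, eq_comm]
        try omega

theorem corollary3p2 {m : ℕ} (P : Polymatroid (Fin m)) (hP : ∃ i : Fin m, P.rk {i} = P.rank) :
    MvPolynomial.IsDenormalizedLorentzian P.rank P.gPoly ∧
      MvPolynomial.IsBasePolytopeLattice {k | P.gPoly.coeff k ≠ 0} := by
  obtain ⟨i, hi⟩ := hP
  refine ⟨P.isLorentzian_normalization_gPoly hi, P.extension (Finset.univ.erase i), ?_⟩
  ext k
  rw [Set.mem_ofPred_eq, Set.mem_ofPred_eq, P.coeff_gPoly hi, Nat.cast_ne_zero,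
    Polymatroid.extensionCount_ne_zero_iff, Polymatroid.cast_mem_basePolytope_iff]
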